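/- Let $M$ be a smooth manifold, $A\subset TM\setminus 0$ an open conic subset and $L:A\to\mathbb R$ a pseudo-Finsler metric: $L$ is smooth, $L(\lambda v)=\lambda^2L(v)$ for $\lambda>0$, and the fundamental tensor $g_v(u,w)=\frac12\frac{\partial^2}{\partial s\partial t}L(v+su+tw)|_{s=t=0}$ is non-degenerate for all $v\in A$. Let $C_v(u,w,z)=\frac12\frac{\partial}{\partial t}g_{v+tz}(u,w)|_{t=0}$ be its Cartan tensor. The Levi-Civita-Chern connection $\widetilde\nabla$ of $(M,L)$ is the unique anisotropic connection that is torsion-free, $\widetilde\nabla^v_XY-\widetilde\nabla^v_YX=[X,Y]$, and satisfies $X(g_V(Y,Z))=g_V(\widetilde\nabla^V_XY,Z)+g_V(Y,\widetilde\nabla^V_XZ)+2C_V(\widetilde\nabla^V_XV,Y,Z)$ for all local vector fields $V,X,Y,Z$ with $V$ taking values in $A$. For an anisotropic connection $\nabla$, an anisotropic vector field $W$ and an anisotropic tensor $T$ of type $(1,2)$, put $$(\nabla_XW)_v=\nabla^v_X(W_V)-(\partial^\nu W)_v(\nabla^v_XV),$$ $$(\nabla_XT)_v(Y,Z)=\nabla^v_X(T_V(Y,Z))-(\partial^\nu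 T)_v(Y,Z,\nabla^v_XV)-T_v(\nabla^v_XY,Z)-T_v(Y,\nabla^v_XZ),$$ where $V$ is any local $A$-valued vector field extending $v$ and $\partial^\nu$ is the derivative in the fibre direction, $(\partial^\nu W)_v(z)=\frac{\partial}{\partial t}W_{v+tz}|_{t=0}$ and $(\partial^\nu T)_v(Y,Z,z)=\frac{\partial}{\partial t}T_{v+tz}(Y,Z)|_{t=0}$. The curvature of $\nabla$ is $R_v(X,Y)Z=\nabla^v_X(\nabla_YZ)-\nabla^v_Y(\nabla_XZ)-\nabla^v_{[X,Y]}Z$, its vertical derivative is $P_v(X,Y,Z)=\frac{\partial}{\partial t}\nabla^{v+tZ}_XY|_{t=0}$. With $\widetilde R$ and $\widetilde P$ those of $\widetilde\nabla$, the flag curvature of $(M,L)$ with flagpole $v\in A$ and flag $u$ is $$\widetilde K_v(u)=\frac{g_v(\widetilde R_v(v,u)u,v)}{L(v)g_v(u,u)-g_v(v,u)^2}\qquad\text{if }L(v)g_v(u,u)-g_v(v,u)^2\neq0.$$ Let $S$ be a (possibly only immersed) non-degenerate submanifold of $(M,L)$, i.e. $g_v$ restricted to $T_{\pi(v)}S$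 is non-degenerate for all $v\in A\cap TS$, where $\pi:TM\to M$ is the projection. Then $L|_S:=L|_{A\cap TS}$ is a pseudo-Finsler metric on $S$; let $\nabla$ be its Levi-Civita-Chern connection and $K$ its flag curvature. For $v\in A\cap TS$ and vector fields $X,Y$ on $S$ decompose $\widetilde\nabla^v_XY=\widehat\nabla^v_XY+\mathrm{II}_v(X,Y)$ into the part tangent to $S$ and the part $g_v$-orthogonal to $S$, and let $Q_v(X,Y)=\widehat\nabla^v_XY-\nabla^v_XY$, an anisotropic tensor of type $(1,2)$ on $S$ with derivative $\nabla Q$. Then for every $v\in A\cap TS$ and $u\in T_{\pi(v)}S$ with $L(v)g_v(u,u)-g_v(v,u)^2\neq0$, $$\begin{aligned}K_v(u)=\widetilde K_v(u)&+\frac{g_v(\mathrm{II}_v(u,u),\mathrm{II}_v(v,v))-g_v(\mathrm{II}_v(v,u),\mathrm{II}_v(v,u))}{L(v)g_v(u,u)-g_v(v,u)^2}\\&+\frac{g_v\big(\widetilde P_v(u,u,\mathrm{II}_v(v,v))-(\nabla_vQ)_v(u,u),v\big)+C_v\big(u,Q_v(v,u),\mathrm{II}_v(v,v)\big)}{L(v)g_v(u,u)-g_v(v,u)^2}.\end{aligned}$$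 -/

import Mathlib

open scoped Manifold ContDiff Bundle

noncomputable section

namespace Finsler

/-! Fibrewise derivatives of a function on a vector space. -/

/-- `½ ∂²/∂s∂t f (v + s u + t w)` at `s = t = 0`. -/
def fundForm {V : Type*} [AddCommGroup V] [Module ℝ V] (f : V → ℝ) (v u w : V) : ℝ :=
  (1 / 2) * deriv (fun s : ℝ => deriv (fun t : ℝ => f (v + s • u + t • w)) 0) 0

/-- `½ ∂/∂t g_{v + t z}(u, w)` at `t = 0`, where `g` is `fundForm f`. -/
def cartanForm {V : Type*} [AddCommGroup V] [Module ℝ V] (f : V → ℝ) (v u w z : V) : ℝ :=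
  (1 / 2) * deriv (fun t : ℝ => fundForm f (v + t • z) u w) 0

/-! Pseudo-Finsler metrics. -/

/-- A pseudo-Finsler metric `L : A → ℝ` on a manifold `M`, with `A ⊆ TM ∖ 0` open and conic
(the values of `L` outside `A` play no role). -/
structure PseudoFinslerMetric (E : Type*) [NormedAddCommGroup E] [NormedSpace ℝ E]
    (M : Type*) [TopologicalSpace M] [ChartedSpace E M] [IsManifold 𝓘(ℝ, E) ∞ M] where
  /-- the domain `A` -/
  A : Set (TangentBundle 𝓘(ℝ, E) M)
  /-- the metric -/
  L : TangentBundle 𝓘(ℝ, E) M → ℝ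
  isOpen_A : IsOpen A
  ne_zero : ∀ (x : M) (v : TangentSpace 𝓘(ℝ, E) x), (⟨x, v⟩ : TangentBundle 𝓘(ℝ, E) M) ∈ A → v ≠ 0
  conic : ∀ (x : M) (v : TangentSpace 𝓘(ℝ, E) x) (c : ℝ), 0 < c →
    (⟨x, v⟩ : TangentBundle 𝓘(ℝ, E) M) ∈ A → (⟨x, c • v⟩ : TangentBundle 𝓘(ℝ, E) M) ∈ A
  smooth : ContMDiffOn 𝓘(ℝ, E).tangent 𝓘(ℝ, ℝ) ∞ L A
  homogeneous : ∀ (x : M) (v : TangentSpace 𝓘(ℝ, E) x) (c : ℝ), 0 < c →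
    (⟨x, v⟩ : TangentBundle 𝓘(ℝ, E) M) ∈ A → L ⟨x, c • v⟩ = c ^ 2 * L ⟨x, v⟩
  nondegenerate : ∀ (x : M) (v : TangentSpace 𝓘(ℝ, E) x),
    (⟨x, v⟩ : TangentBundle 𝓘(ℝ, E) M) ∈ A → ∀ u : TangentSpace 𝓘(ℝ, E) x,
      (∀ w : TangentSpace 𝓘(ℝ, E) x,
        fundForm (fun z : TangentSpace 𝓘(ℝ, E) x => L ⟨x, z⟩) v u w = 0) → u = 0

/-! Anisotropic calculus in a coordinate domain of a vector space `E`.  A point `q = (y, η)` of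
`E × E` is the tangent vector with base point `y` and components `η`; a metric is a function
`f : E × E → ℝ`, an anisotropic vector field is a map `E × E → E`, an anisotropic tensor of type
`(1, 2)` is a map `T : E × E → E → E → E`, and an anisotropic connection `∇` is given by its
Christoffel symbols `Γ`, i.e. `∇^q_X Y = DY(X) + Γ q X Y`. -/

section Local

variable {E : Type*} [NormedAddCommGroup E] [NormedSpace ℝ E]

/-- The fundamental tensor of `f` at `q`. -/
def fundTensor (f : E × E → ℝ) (q : E × E) (u w : E) : ℝ :=
  fundForm (fun z : E => f (q.1, z)) q.2 u w

/-- The Cartan tensor of `f` at `q`. -/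
def cartanTensor (f : E × E → ℝ) (q : E × E) (u w z : E) : ℝ :=
  cartanForm (fun ζ : E => f (q.1, ζ)) q.2 u w z

/-- `B` is the value at `q` of the Christoffel symbols of a torsion-free connection which is
almost `g`-compatible:
`X (g_V(Y, Z)) = g_V(∇_X Y, Z) + g_V(Y, ∇_X Z) + 2 C_V(∇_X V, Y, Z)`, written out for the
coordinate-constant fields `Y`, `Z` and the coordinate-constant extension `V` of `q`. -/
structure IsLeviCivitaChern (f : E × E → ℝ) (q : E × E) (B : E →ₗ[ℝ] E →ₗ[ℝ] E) : Prop where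
  torsion_free : ∀ X Y : E, B X Y = B Y X
  compatible : ∀ X Y Z : E,
    deriv (fun t : ℝ => fundTensor f (q.1 + t • X, q.2) Y Z) 0
      = fundTensor f q (B X Y) Z + fundTensor f q Y (B X Z) + 2 * cartanTensor f q (B X q.2) Y Z

/-- The Christoffel symbols of the Levi-Civita-Chern connection of `f`: at every `q` they are the
solution (unique, for a pseudo-Finsler metric) of the torsion-free and compatibility conditions. -/
def chernSymbol (f : E × E → ℝ) (q : E × E) : E →ₗ[ℝ] E →ₗ[ℝ] E :=
  Classical.epsilon (IsLeviCivitaChern f q)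

/-- Vertical derivative `(∂^ν T)_q(a, b, z)`. -/
def vertDeriv (T : E × E → E → E → E) (q : E × E) (a b z : E) : E :=
  deriv (fun t : ℝ => T (q.1, q.2 + t • z) a b) 0

/-- `(∇_X W)_q = ∇^q_X (W_V) - (∂^ν W)_q(∇^q_X V)` for an anisotropic vector field `W`, with `V` the
coordinate-constant extension of `q`. -/
def covDerivField (Γ : E × E → E → E → E) (X : E) (W : E × E → E) (q : E × E) : E :=
  deriv (fun t : ℝ => W (q.1 + t • X, q.2)) 0 + Γ q X (W q)
    - deriv (fun t : ℝ => W (q.1, q.2 + t • Γ q X q.2)) 0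

/-- `(∇_X T)_q(a, b) = ∇^q_X (T_V(a, b)) - (∂^ν T)_q(a, b, ∇^q_X V) - T_q(∇^q_X a, b) - T_q(a, ∇^q_X b)`
for an anisotropic tensor `T` of type `(1, 2)`, with the coordinate-constant extensions `V` of `q`
and of `a`, `b`. -/
def covDerivTensor (Γ : E × E → E → E → E) (X : E) (T : E × E → E → E → E) (q : E × E) (a b : E) :
    E :=
  covDerivField Γ X (fun r => T r a b) q - T q (Γ q X a) b - T q a (Γ q X b)

/-- The curvature `R_q(X, Y)Z = ∇^q_X(∇_Y Z) - ∇^q_Y(∇_X Z) - ∇^q_{[X, Y]} Z`, computed with the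
coordinate-constant (hence commuting) extensions of `X`, `Y`, `Z`; thus `∇_Y Z` is the anisotropic
vector field `r ↦ Γ r Y Z`. -/
def curvature (Γ : E × E → E → E → E) (q : E × E) (X Y Z : E) : E :=
  covDerivField Γ X (fun r => Γ r Y Z) q - covDerivField Γ Y (fun r => Γ r X Z) q

variable {E' : Type*} [NormedAddCommGroup E'] [NormedSpace ℝ E']

/-- The differential of `φ : E' → E` as a map of tangent vectors. -/
def push (φ : E' → E) (q : E' × E') : E × E := (φ q.1, fderiv ℝ φ q.1 q.2)

/-- For an immersion `φ` of coordinate domains and an ambient connection `Γ`: the ambient covariant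
derivative of the coordinate field `b` of the submanifold in the direction of the coordinate field
`a`, with reference vector `dφ(q)`. -/
def ambientDeriv (φ : E' → E) (Γ : E × E → E → E → E) (q : E' × E') (a b : E') : E :=
  deriv (fun t : ℝ => fderiv ℝ φ (q.1 + t • a) b) 0
    + Γ (push φ q) (fderiv ℝ φ q.1 a) (fderiv ℝ φ q.1 b)

/-- The tangent part of `w` in the decomposition into a vector `dφ(t)` and a vector that is
`g_{dφ(q)}`-orthogonal to the image of `dφ`; the value is the vector `t`. -/
def tangentPart (f : E × E → ℝ) (φ : E' → E) (q : E' × E') (w : E) : E' :=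
  Classical.epsilon fun t : E' =>
    ∀ z : E', fundTensor f (push φ q) (w - fderiv ℝ φ q.1 t) (fderiv ℝ φ q.1 z) = 0

/-- The Christoffel symbols of the connection induced on the submanifold by the
Levi-Civita-Chern connection of the ambient metric `f`. -/
def inducedSymbol (f : E × E → ℝ) (φ : E' → E) (q : E' × E') (a b : E') : E' :=
  tangentPart f φ q (ambientDeriv φ (fun r X Y => chernSymbol f r X Y) q a b)

/-- The second fundamental form: the orthogonal part of the ambient derivative. -/
def secondForm (f : E × E → ℝ) (φ : E' → E) (q : E' × E') (a b : E') : E :=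
  ambientDeriv φ (fun r X Y => chernSymbol f r X Y) q a b
    - fderiv ℝ φ q.1 (inducedSymbol f φ q a b)

/-- The difference tensor of the connection induced by `f` and the Levi-Civita-Chern connection of
the metric `f'` of the submanifold. -/
def differenceTensor (f : E × E → ℝ) (φ : E' → E) (f' : E' × E' → ℝ) (q : E' × E') (a b : E') : E' :=
  inducedSymbol f φ q a b - chernSymbol f' q a b

end Local

/-! The objects on manifolds.  At a point `x` they are computed in the preferred chart at `x`, in
which `T_xM` is identified with `E` (by definition in Mathlib). -/

namespace PseudoFinslerMetric

variable {E : Type*} [NormedAddCommGroup E] [NormedSpace ℝ E]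
  {M : Type*} [TopologicalSpace M] [ChartedSpace E M] [IsManifold 𝓘(ℝ, E) ∞ M]

/-- The fundamental tensor `g_v(u, w)`. -/
def g (F : PseudoFinslerMetric E M) {x : M} (v u w : TangentSpace 𝓘(ℝ, E) x) : ℝ :=
  fundForm (fun z : TangentSpace 𝓘(ℝ, E) x => F.L ⟨x, z⟩) v u w

/-- The Cartan tensor `C_v(u, w, z)`. -/
def cartan (F : PseudoFinslerMetric E M) {x : M} (v u w z : TangentSpace 𝓘(ℝ, E) x) : ℝ :=
  cartanForm (fun z : TangentSpace 𝓘(ℝ, E) x => F.L ⟨x, z⟩) v u w z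

/-- The metric read in the chart of `TM` induced by the preferred chart of `M` at `x`. -/
def inChart (F : PseudoFinslerMetric E M) (x : M) (q : E × E) : ℝ :=
  F.L ((extChartAt 𝓘(ℝ, E).tangent (⟨x, 0⟩ : TangentBundle 𝓘(ℝ, E) M)).symm q)

/-- The tangent vector `v` at `x`, in the chart at `x`. -/
def coord {x : M} (v : TangentSpace 𝓘(ℝ, E) x) : E × E := (extChartAt 𝓘(ℝ, E) x x, v)

/-- The Christoffel symbols, in the chart at `x`, of the Levi-Civita-Chern connection. -/
def symbol (F : PseudoFinslerMetric E M) (x : M) : E × E → E → E → E :=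
  fun q X Y => chernSymbol (F.inChart x) q X Y

/-- The curvature tensor `R_v(X, Y)Z` of the Levi-Civita-Chern connection. -/
def R (F : PseudoFinslerMetric E M) {x : M} (v X Y Z : TangentSpace 𝓘(ℝ, E) x) :
    TangentSpace 𝓘(ℝ, E) x :=
  curvature (E := E) (F.symbol x) (coord v) X Y Z

/-- The vertical derivative `P_v(X, Y, Z)` of the Levi-Civita-Chern connection. -/
def P (F : PseudoFinslerMetric E M) {x : M} (v X Y Z : TangentSpace 𝓘(ℝ, E) x) :
    TangentSpace 𝓘(ℝ, E) x :=
  vertDeriv (E := E) (F.symbol x) (coord v) X Y Z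

/-- The quantity `L(v) g_v(u, u) - g_v(v, u)²`. -/
def flagDenom (F : PseudoFinslerMetric E M) {x : M} (v u : TangentSpace 𝓘(ℝ, E) x) : ℝ :=
  F.L ⟨x, v⟩ * F.g v u u - F.g v v u ^ 2

/-- The flag curvature `K_v(u)` with flagpole `v` and flag `u`. -/
def flagCurvature (F : PseudoFinslerMetric E M) {x : M} (v u : TangentSpace 𝓘(ℝ, E) x) : ℝ :=
  F.g v (F.R v v u u) v / F.flagDenom v u

variable {E' : Type*} [NormedAddCommGroup E'] [NormedSpace ℝ E']
  {S : Type*} [TopologicalSpace S] [ChartedSpace E' S] [IsManifold 𝓘(ℝ, E') ∞ S]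

variable (E') in
/-- `ι : S → M` is a smooth immersion that makes `S` a non-degenerate submanifold of `(M, L)`: the
restriction of `g_v` to `T_pS` is non-degenerate for all `v ∈ A ∩ TS`. -/
structure IsNondegenerate (F : PseudoFinslerMetric E M) (ι : S → M) : Prop where
  smooth : ContMDiff 𝓘(ℝ, E') 𝓘(ℝ, E) ∞ ι
  injective : ∀ p : S, Function.Injective (mfderiv 𝓘(ℝ, E') 𝓘(ℝ, E) ι p)
  nondegenerate : ∀ (p : S) (v : TangentSpace 𝓘(ℝ, E') p),
    (⟨ι p, mfderiv 𝓘(ℝ, E') 𝓘(ℝ, E) ι p v⟩ : TangentBundle 𝓘(ℝ, E) M) ∈ F.A →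
      ∀ u : TangentSpace 𝓘(ℝ, E') p,
        (∀ w : TangentSpace 𝓘(ℝ, E') p,
          F.g (mfderiv 𝓘(ℝ, E') 𝓘(ℝ, E) ι p v) (mfderiv 𝓘(ℝ, E') 𝓘(ℝ, E) ι p u)
            (mfderiv 𝓘(ℝ, E') 𝓘(ℝ, E) ι p w) = 0) → u = 0

theorem fundForm_comp_linear {V W : Type*} [AddCommGroup V] [Module ℝ V] [AddCommGroup W]
    [Module ℝ W] (D : V →ₗ[ℝ] W) (f : W → ℝ) (v u w : V) :
    fundForm (fun z => f (D z)) v u w = fundForm f (D v) (D u) (D w) := by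
  simp [fundForm]

/-- The restriction `L|_S` of the metric to `A ∩ TS`. -/
def restrict (F : PseudoFinslerMetric E M) (ι : S → M) (hι : F.IsNondegenerate E' ι) :
    PseudoFinslerMetric E' S where
  A := {w | tangentMap 𝓘(ℝ, E') 𝓘(ℝ, E) ι w ∈ F.A}
  L := fun w => F.L (tangentMap 𝓘(ℝ, E') 𝓘(ℝ, E) ι w)
  isOpen_A := F.isOpen_A.preimage
    (hι.smooth.contMDiff_tangentMap (m := ∞) (by simp)).continuous
  ne_zero := by
    rintro p v hv rfl
    exact F.ne_zero _ _ hv (map_zero (mfderiv 𝓘(ℝ, E') 𝓘(ℝ, E) ι p))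
  conic := by
    intro p v c hc hv
    have h := F.conic _ _ c hc hv
    rw [← map_smul] at h
    exact h
  smooth := F.smooth.comp
    (hι.smooth.contMDiff_tangentMap (m := ∞) (by simp)).contMDiffOn (fun _ h => h)
  homogeneous := by
    intro p v c hc hv
    have h := F.homogeneous _ _ c hc hv
    rw [← map_smul] at h
    exact h
  nondegenerate := by
    intro p v hv u hu
    refine hι.nondegenerate p v hv u fun w => ?_
    rw [← hu w]
    exact (fundForm_comp_linear (mfderiv 𝓘(ℝ, E') 𝓘(ℝ, E) ι p).toLinearMap
      (fun z => F.L ⟨ι p, z⟩) v u w).symm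

/-- The second fundamental form `II_v(a, b)`, for `v` in `A ∩ TS`. -/
def II (F : PseudoFinslerMetric E M) (ι : S → M) {p : S} (v a b : TangentSpace 𝓘(ℝ, E') p) :
    TangentSpace 𝓘(ℝ, E) (ι p) :=
  secondForm (E := E) (E' := E') (F.inChart (ι p)) (writtenInExtChartAt 𝓘(ℝ, E') 𝓘(ℝ, E) p ι) (coord v) a b

/-- The difference tensor `Q = ∇̂ - ∇` of the induced connection and the Levi-Civita-Chern
connection of `(S, L|_S)`, in the charts at `p` and `ι p`. -/
def Qsymbol (F : PseudoFinslerMetric E M) (ι : S → M) (hι : F.IsNondegenerate E' ι) (p : S) :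
    E' × E' → E' → E' → E' :=
  differenceTensor (F.inChart (ι p)) (writtenInExtChartAt 𝓘(ℝ, E') 𝓘(ℝ, E) p ι)
    ((F.restrict ι hι).inChart p)

/-- The difference tensor `Q_v(a, b)`. -/
def Q (F : PseudoFinslerMetric E M) (ι : S → M) (hι : F.IsNondegenerate E' ι) {p : S}
    (v a b : TangentSpace 𝓘(ℝ, E') p) : TangentSpace 𝓘(ℝ, E') p :=
  F.Qsymbol (E' := E') ι hι p (coord v) a b

/-- The derivative `(∇_w Q)_v(a, b)` with respect to the Levi-Civita-Chern connection of
`(S, L|_S)`. -/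
def nablaQ (F : PseudoFinslerMetric E M) (ι : S → M) (hι : F.IsNondegenerate E' ι) {p : S}
    (w v a b : TangentSpace 𝓘(ℝ, E') p) : TangentSpace 𝓘(ℝ, E') p :=
  covDerivTensor (E := E') ((F.restrict ι hι).symbol p) w (F.Qsymbol ι hι p) (coord v) a b

end PseudoFinslerMetric

end Finsler

end

/-! Everything is computed in charts. A tangent vector is a point `q = (y, η)`, and the covariant
derivative of an anisotropic field is its ordinary derivative along the horizontal vector `(X, -Γ q
X η)` plus a Christoffel term (`covDerivField_eq`). Homogeneity of the metric gives Euler's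
relations: the Cartan tensor vanishes on the flagpole, and `g_v(P_v(X, v, z), v) = 0`
(`metricForm_fderiv_chernMap_self`).

The geometric core is `fderiv_push_horizontal`. The differential of the immersion does not map
horizontal vectors of the submanifold to horizontal vectors of the ambient space: they differ by the
vertical vector `Q_v(a, v) + II_v(a, v)`. When the ambient Christoffel symbols are differentiated
along the submanifold, this vertical error produces `P` terms (`curvature_push`); when the metric is
differentiated, it produces Cartan terms. Pairing with the flagpole removes the Cartan terms and
leaves the tangent part and the products of second fundamental forms
(`metricForm_fderiv_horizontal`, `metricForm_covDeriv_ambientDeriv`).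

Comparing the two compatibility conditions on the submanifold determines the part of `Q` that is
needed (`metricForm_differenceTensor` and its consequences): `Q_v(v, v) = 0`, `g(Q(a, b), v) = -g(b,
Q(a, v))` and `g(Q(a, v), c) = -C(a, c, II(v, v))`. These turn the leftover `Q` terms into `∇Q` and
one Cartan term, which gives the Gauss equation `metricForm_curvature`. Finally the charts are
removed, and both curvatures are divided by the common denominator. -/

noncomputable section

namespace Finsler

set_option maxSynthPendingDepth 3

/-! ### Directional derivatives and horizontal lifts. -/

section Derivatives

variable {E F : Type*} [NormedAddCommGroup E] [NormedSpace ℝ E]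
  [NormedAddCommGroup F] [NormedSpace ℝ F]

theorem hasDerivAt_line {W : E → F} {q : E} (hW : DifferentiableAt ℝ W q) (a : E) :
    HasDerivAt (fun t : ℝ => W (q + t • a)) (fderiv ℝ W q a) 0 := by
  have h1 : HasDerivAt (fun t : ℝ => q + t • a) a 0 := by
    simpa using ((hasDerivAt_id (0 : ℝ)).smul_const a).const_add q
  have h2 : HasFDerivAt W (fderiv ℝ W q) (q + (0 : ℝ) • a) := by simpa using hW.hasFDerivAt
  exact h2.comp_hasDerivAt (0 : ℝ) h1

theorem deriv_horizontal {W : E × E → F} {q : E × E} (hW : DifferentiableAt ℝ W q) (a : E) :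
    deriv (fun t : ℝ => W (q.1 + t • a, q.2)) 0 = fderiv ℝ W q (a, 0) := by
  rw [← (hasDerivAt_line hW (a, 0)).deriv]
  congr 1; ext t; congr 1; ext <;> simp

theorem deriv_vertical {W : E × E → F} {q : E × E} (hW : DifferentiableAt ℝ W q) (z : E) :
    deriv (fun t : ℝ => W (q.1, q.2 + t • z)) 0 = fderiv ℝ W q (0, z) := by
  rw [← (hasDerivAt_line hW (0, z)).deriv]
  congr 1; ext t; congr 1; ext <;> simp

/-- The horizontal and vertical line derivatives combine into one Fréchet derivative along the
horizontal lift of `a`. In this form the chain and product rules apply directly. -/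
theorem covDerivField_eq (Γ : E × E → E → E → E) (a : E) {W : E × E → E} {q : E × E}
    (hW : DifferentiableAt ℝ W q) :
    covDerivField Γ a W q = fderiv ℝ W q (a, -Γ q a q.2) + Γ q a (W q) := by
  rw [covDerivField, deriv_horizontal hW, deriv_vertical hW]
  have : (a, -Γ q a q.2) = (a, (0 : E)) - (0, Γ q a q.2) := by simp
  rw [this, map_sub]; abel

end Derivatives

/-! ### Local metrics: fundamental tensor, Cartan tensor and Euler relations. -/

theorem minSmoothness_two_le : minSmoothness ℝ 2 ≤ ∞ := by
  rw [minSmoothness_of_isRCLikeNormedField]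
  exact WithTop.coe_le_coe.2 (le_top (a := (2 : ℕ∞)))

/-- `f` is a smooth, fibrewise positively homogeneous function of degree two on the open conic set
`U`, with non-degenerate fundamental tensor. -/
structure LocalMetric {E : Type*} [NormedAddCommGroup E] [NormedSpace ℝ E]
    (f : E × E → ℝ) (U : Set (E × E)) : Prop where
  isOpen : IsOpen U
  smooth : ContDiffOn ℝ ∞ f U
  conic : ∀ q ∈ U, ∀ c : ℝ, 0 < c → (q.1, c • q.2) ∈ U
  homogeneous : ∀ q ∈ U, ∀ c : ℝ, 0 < c → f (q.1, c • q.2) = c ^ 2 * f q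
  nondegenerate : ∀ q ∈ U, ∀ u, (∀ w, fundTensor f q u w = 0) → u = 0

section MetricForm

variable {E : Type*} [NormedAddCommGroup E] [NormedSpace ℝ E]

/-- The fundamental tensor as a continuous bilinear form, through the second derivative. -/
def metricForm (f : E × E → ℝ) (q : E × E) : E →L[ℝ] E →L[ℝ] ℝ :=
  (1 / 2 : ℝ) • (fderiv ℝ (fderiv ℝ f) q).bilinearComp
    (ContinuousLinearMap.inr ℝ E E) (ContinuousLinearMap.inr ℝ E E)

theorem metricForm_apply (f : E × E → ℝ) (q : E × E) (u w : E) :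
    metricForm f q u w = 1 / 2 * fderiv ℝ (fderiv ℝ f) q (0, u) (0, w) := by
  simp [metricForm]

namespace LocalMetric

variable {f : E × E → ℝ} {U : Set (E × E)} {q : E × E}

theorem contDiffAt (h : LocalMetric f U) (hq : q ∈ U) : ContDiffAt ℝ ∞ f q :=
  h.smooth.contDiffAt (h.isOpen.mem_nhds hq)

theorem contDiffAt_fderiv (h : LocalMetric f U) (hq : q ∈ U) : ContDiffAt ℝ ∞ (fderiv ℝ f) q :=
  (h.contDiffAt hq).fderiv_right (by simp)

theorem contDiffAt_fderiv_fderiv (h : LocalMetric f U) (hq : q ∈ U) :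
    ContDiffAt ℝ ∞ (fderiv ℝ (fderiv ℝ f)) q :=
  (h.contDiffAt_fderiv hq).fderiv_right (by simp)

theorem contDiffAt_metricForm [FiniteDimensional ℝ E] (h : LocalMetric f U) (hq : q ∈ U) :
    ContDiffAt ℝ ∞ (metricForm f) q := by
  refine (contDiffOn_clm_apply.2 fun u => contDiffOn_clm_apply.2 fun w => ?_ :
    ContDiffOn ℝ ∞ (metricForm f) U).contDiffAt (h.isOpen.mem_nhds hq)
  intro r hr
  simp only [metricForm_apply]
  exact (contDiffAt_const.mul (((h.contDiffAt_fderiv_fderiv hr).clm_apply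
    contDiffAt_const).clm_apply contDiffAt_const)).contDiffWithinAt

theorem differentiableAt_metricForm [FiniteDimensional ℝ E] (h : LocalMetric f U) (hq : q ∈ U) :
    DifferentiableAt ℝ (metricForm f) q :=
  (h.contDiffAt_metricForm hq).differentiableAt (by simp)

theorem metricForm_comm (h : LocalMetric f U) (hq : q ∈ U) (u w : E) :
    metricForm f q u w = metricForm f q w u := by
  rw [metricForm_apply, metricForm_apply,
    ((h.contDiffAt hq).isSymmSndFDerivAt minSmoothness_two_le).eq]

theorem eventually_mem_vertical (h : LocalMetric f U) (hq : q ∈ U) (z : E) :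
    ∀ᶠ t : ℝ in nhds 0, (q.1, q.2 + t • z) ∈ U := by
  have : Continuous fun t : ℝ => (q.1, q.2 + t • z) := by fun_prop
  exact this.continuousAt.eventually (h.isOpen.mem_nhds (by simpa using hq))

theorem eventually_mem_horizontal (h : LocalMetric f U) (hq : q ∈ U) (a : E) :
    ∀ᶠ t : ℝ in nhds 0, (q.1 + t • a, q.2) ∈ U := by
  have : Continuous fun t : ℝ => (q.1 + t • a, q.2) := by fun_prop
  exact this.continuousAt.eventually (h.isOpen.mem_nhds (by simpa using hq))

theorem fundTensor_eq (h : LocalMetric f U) (hq : q ∈ U) (u w : E) :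
    fundTensor f q u w = metricForm f q u w := by
  have h1 : (fun s : ℝ => deriv (fun t : ℝ => f (q.1, q.2 + s • u + t • w)) 0)
      =ᶠ[nhds 0] fun s : ℝ => fderiv ℝ f (q.1, q.2 + s • u) (0, w) := by
    filter_upwards [h.eventually_mem_vertical hq u] with s hs
    exact deriv_vertical ((h.contDiffAt hs).differentiableAt (by simp)) w
  have hd : DifferentiableAt ℝ (fun r => fderiv ℝ f r (0, w)) q :=
    ((h.contDiffAt_fderiv hq).differentiableAt (by simp)).clm_apply (differentiableAt_const _)
  rw [fundTensor, fundForm, h1.deriv_eq,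
    deriv_vertical (W := fun r => fderiv ℝ f r (0, w)) hd, metricForm_apply,
    fderiv_clm_apply ((h.contDiffAt_fderiv hq).differentiableAt (by simp))
      (differentiableAt_const _)]
  simp

theorem eq_zero_of_metricForm (h : LocalMetric f U) (hq : q ∈ U) {u : E}
    (hu : ∀ w, metricForm f q u w = 0) : u = 0 :=
  h.nondegenerate q hq u fun w => by rw [h.fundTensor_eq hq, hu]

/-- Euler's relation. -/
theorem fderiv_vertical_self (h : LocalMetric f U) (hq : q ∈ U) :
    fderiv ℝ f q (0, q.2) = 2 * f q := by
  rw [← deriv_vertical ((h.contDiffAt hq).differentiableAt (by simp))]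
  have h1 : (fun t : ℝ => f (q.1, q.2 + t • q.2)) =ᶠ[nhds 0] fun t : ℝ => (1 + t) ^ 2 * f q := by
    -- Homogeneity holds only for positive factors, so `t > -1` keeps `1 + t` admissible.
    filter_upwards [lt_mem_nhds (show (-1 : ℝ) < 0 by norm_num)] with t ht
    rw [← h.homogeneous q hq (1 + t) (by linarith), add_smul, one_smul]
  rw [h1.deriv_eq]
  have h2 : HasDerivAt (fun t : ℝ => (1 + t) ^ 2 * f q) ((2 * (1 + 0) ^ 1 * 1) * f q) 0 := by
    have := (((hasDerivAt_id (0 : ℝ)).const_add 1).pow 2).mul_const (f q)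
    simpa using this
  rw [h2.deriv]; ring

/-- Euler's relation differentiated vertically: the second derivative contributes `D²f((0, w), (0,
η))` and the moving argument contributes one copy of `Df(0, w)`, against two copies on the right. -/
theorem metricForm_self_right (h : LocalMetric f U) (hq : q ∈ U) (w : E) :
    metricForm f q w q.2 = 1 / 2 * fderiv ℝ f q (0, w) := by
  have h1 : (fun p : E × E => fderiv ℝ f p (0, p.2)) =ᶠ[nhds q] fun p => 2 * f p := by
    filter_upwards [h.isOpen.mem_nhds hq] with p hp using h.fderiv_vertical_self hp
  have h2 := DFunLike.congr_fun (h1.fderiv_eq (𝕜 := ℝ)) (0, w)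
  rw [fderiv_const_mul ((h.contDiffAt hq).differentiableAt (by simp)),
    fderiv_clm_apply ((h.contDiffAt_fderiv hq).differentiableAt (by simp)) (by fun_prop)] at h2
  have h3 : fderiv ℝ (fun p : E × E => ((0 : E), p.2)) q (0, w) = (0, w) := by
    rw [DifferentiableAt.fderiv_prodMk (by fun_prop) (by fun_prop)]
    simp [fderiv_snd]
  simp [h3] at h2
  rw [metricForm_apply]
  linarith

theorem metricForm_self_self (h : LocalMetric f U) (hq : q ∈ U) :
    metricForm f q q.2 q.2 = f q := by
  rw [h.metricForm_self_right hq, h.fderiv_vertical_self hq]; ring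

section FiniteDimensional

variable [FiniteDimensional ℝ E]

theorem fderiv_metricForm_apply (h : LocalMetric f U) (hq : q ∈ U) (r : E × E) (u w : E) :
    fderiv ℝ (fun p => metricForm f p u w) q r = fderiv ℝ (metricForm f) q r u w := by
  have h1 := h.differentiableAt_metricForm hq
  have h2 : DifferentiableAt ℝ (fun p => metricForm f p u) q :=
    h1.clm_apply (differentiableAt_const _)
  rw [fderiv_clm_apply h2 (differentiableAt_const _), fderiv_clm_apply h1 (differentiableAt_const _)]
  simp

theorem fderiv_metricForm (h : LocalMetric f U) (hq : q ∈ U) (r : E × E) (u w : E) :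
    fderiv ℝ (metricForm f) q r u w
      = 1 / 2 * fderiv ℝ (fderiv ℝ (fderiv ℝ f)) q r (0, u) (0, w) := by
  rw [← h.fderiv_metricForm_apply hq]
  have h1 := (h.contDiffAt_fderiv_fderiv hq).differentiableAt (by simp)
  have h2 : DifferentiableAt ℝ (fun p => fderiv ℝ (fderiv ℝ f) p (0, u)) q :=
    h1.clm_apply (differentiableAt_const _)
  simp only [metricForm_apply]
  rw [fderiv_const_mul (h2.clm_apply (differentiableAt_const _)),
    fderiv_clm_apply h2 (differentiableAt_const _), fderiv_clm_apply h1 (differentiableAt_const _)]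
  simp

theorem fderiv_metricForm_comm (h : LocalMetric f U) (hq : q ∈ U) (r : E × E) (u w : E) :
    fderiv ℝ (metricForm f) q r u w = fderiv ℝ (metricForm f) q r w u := by
  rw [← h.fderiv_metricForm_apply hq, ← h.fderiv_metricForm_apply hq]
  have : (fun p => metricForm f p u w) =ᶠ[nhds q] fun p => metricForm f p w u := by
    filter_upwards [h.isOpen.mem_nhds hq] with p hp using h.metricForm_comm hp u w
  rw [this.fderiv_eq]

/-- Together with the symmetry of `g`, this makes the Cartan tensor totally symmetric: it is a third
fibre derivative of `f`. -/
theorem fderiv_metricForm_vertical_comm (h : LocalMetric f U) (hq : q ∈ U) (z u w : E) :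
    fderiv ℝ (metricForm f) q (0, z) u w = fderiv ℝ (metricForm f) q (0, u) z w := by
  rw [h.fderiv_metricForm hq, h.fderiv_metricForm hq,
    ((h.contDiffAt_fderiv hq).isSymmSndFDerivAt minSmoothness_two_le).eq]

theorem cartanTensor_eq (h : LocalMetric f U) (hq : q ∈ U) (u w z : E) :
    cartanTensor f q u w z = 1 / 2 * fderiv ℝ (metricForm f) q (0, u) w z := by
  have h1 : (fun t : ℝ => fundForm (fun ζ => f (q.1, ζ)) (q.2 + t • z) u w)
      =ᶠ[nhds 0] fun t : ℝ => metricForm f (q.1, q.2 + t • z) u w := by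
    filter_upwards [h.eventually_mem_vertical hq z] with t ht
    exact h.fundTensor_eq ht u w
  rw [cartanTensor, cartanForm, h1.deriv_eq,
    deriv_vertical (W := fun p => metricForm f p u w), h.fderiv_metricForm_apply hq,
    h.fderiv_metricForm_vertical_comm hq, h.fderiv_metricForm_comm hq]
  exact ((h.differentiableAt_metricForm hq).clm_apply (differentiableAt_const _)).clm_apply
    (differentiableAt_const _)

/-- The Cartan tensor vanishes on the reference vector. -/
theorem fderiv_metricForm_vertical_self (h : LocalMetric f U) (hq : q ∈ U) (z w : E) :
    fderiv ℝ (metricForm f) q (0, z) w q.2 = 0 := by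
  -- Differentiating `g_v(w, v) = ½ Df(0, w)` vertically yields `g_v(w, z)` on both sides, so the
  -- derivative of `g` itself must contribute nothing.
  have h1 : (fun p : E × E => metricForm f p w p.2) =ᶠ[nhds q]
      fun p => 1 / 2 * fderiv ℝ f p (0, w) := by
    filter_upwards [h.isOpen.mem_nhds hq] with p hp using h.metricForm_self_right hp w
  have h2 := DFunLike.congr_fun (h1.fderiv_eq (𝕜 := ℝ)) (0, z)
  have hG := h.differentiableAt_metricForm hq
  have hd := (h.contDiffAt_fderiv hq).differentiableAt (by simp)
  rw [fderiv_const_mul (hd.clm_apply (differentiableAt_const _)),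
    fderiv_clm_apply hd (by fun_prop),
    fderiv_clm_apply (hG.clm_apply (differentiableAt_const _)) (by fun_prop),
    fderiv_clm_apply hG (by fun_prop)] at h2
  simp [fderiv_snd] at h2
  have h3 := metricForm_apply f q z w
  rw [h.metricForm_comm hq] at h3
  linarith

theorem fderiv_metricForm_vertical_self_left (h : LocalMetric f U) (hq : q ∈ U) (z w : E) :
    fderiv ℝ (metricForm f) q (0, z) q.2 w = 0 := by
  rw [h.fderiv_metricForm_comm hq, h.fderiv_metricForm_vertical_self hq]

end FiniteDimensional

end LocalMetric

end MetricForm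

/-! ### Inverting nondegenerate bilinear forms. -/

section NondegenerateForms

variable {E : Type*} [NormedAddCommGroup E] [NormedSpace ℝ E] [FiniteDimensional ℝ E]

theorem exists_continuousLinearEquiv_of_nondegenerate (B : E →L[ℝ] E →L[ℝ] ℝ)
    (hB : ∀ u, (∀ w, B u w = 0) → u = 0) :
    ∃ e : E ≃L[ℝ] (E →L[ℝ] ℝ), (e : E →L[ℝ] (E →L[ℝ] ℝ)) = B := by
  have hinj : Function.Injective (B : E →ₗ[ℝ] (E →L[ℝ] ℝ)) := by
    refine (injective_iff_map_eq_zero _).2 fun u hu => hB u fun w => ?_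
    have : B u = 0 := hu
    rw [this]; rfl
  have hr : Module.finrank ℝ E = Module.finrank ℝ (E →L[ℝ] ℝ) := by
    rw [← (LinearMap.toContinuousLinearMap : (E →ₗ[ℝ] ℝ) ≃ₗ[ℝ] (E →L[ℝ] ℝ)).finrank_eq]
    exact (Subspace.dual_finrank_eq (K := ℝ) (V := E)).symm
  refine ⟨(LinearMap.linearEquivOfInjective _ hinj hr).toContinuousLinearEquiv, ?_⟩
  ext; rfl

/-- The Christoffel symbols and tangent parts are chosen pointwise and known only through their
pairings with all vectors. Their smoothness is recovered here from `W = B⁻¹(B W)`, since inversion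
of continuous linear equivalences is smooth. -/
theorem contDiffOn_of_nondegenerate {P : Type*} [NormedAddCommGroup P] [NormedSpace ℝ P]
    {n : WithTop ℕ∞} {s : Set P} (hs : IsOpen s) {B : P → E →L[ℝ] E →L[ℝ] ℝ}
    (hB : ContDiffOn ℝ n B s) (hnd : ∀ p ∈ s, ∀ u, (∀ w, B p u w = 0) → u = 0)
    {W : P → E} (hW : ∀ z, ContDiffOn ℝ n (fun p => B p (W p) z) s) : ContDiffOn ℝ n W s := by
  have : CompleteSpace E := FiniteDimensional.complete ℝ E
  have h1 : ContDiffOn ℝ n (fun p => B p (W p)) s := contDiffOn_clm_apply.2 hW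
  intro p hp
  obtain ⟨e, he⟩ := exists_continuousLinearEquiv_of_nondegenerate (B p) (hnd p hp)
  have h2 : ContDiffAt ℝ n (fun p => (B p).inverse) p := by
    have := contDiffAt_map_inverse (n := n) (𝕜 := ℝ) e
    rw [he] at this
    exact this.comp p (hB.contDiffAt (hs.mem_nhds hp))
  refine (h2.clm_apply (h1.contDiffAt (hs.mem_nhds hp))).contDiffWithinAt.congr_of_mem
    (fun r hr => ?_) hp
  obtain ⟨e, he⟩ := exists_continuousLinearEquiv_of_nondegenerate (B r) (hnd r hr)
  rw [← he, ContinuousLinearMap.inverse_equiv]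
  simp

end NondegenerateForms

/-! ### The Koszul argument as linear algebra. -/

section Koszul

variable {V : Type*} [AddCommGroup V] [Module ℝ V]

/-- The trilinear form of the Koszul formula. -/
def koszulForm (δ : V →ₗ[ℝ] V →ₗ[ℝ] V →ₗ[ℝ] ℝ) : V →ₗ[ℝ] V →ₗ[ℝ] V →ₗ[ℝ] ℝ :=
  LinearMap.mk₂ ℝ
    (fun X Y =>
      { toFun := fun Z => 1 / 2 * (δ X Y Z + δ Y X Z - δ Z X Y)
        map_add' := by intros; simp; ring
        map_smul' := by intros; simp; ring })
    (by intros; ext; simp; ring) (by intros; ext; simp; ring)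
    (by intros; ext; simp; ring) (by intros; ext; simp; ring)

theorem koszulForm_apply (δ : V →ₗ[ℝ] V →ₗ[ℝ] V →ₗ[ℝ] ℝ) (X Y Z : V) :
    koszulForm δ X Y Z = 1 / 2 * (δ X Y Z + δ Y X Z - δ Z X Y) := rfl

/-- The linear algebra behind the existence of the Levi-Civita-Chern connection. -/
theorem exists_torsionFree_compatible (e : V ≃ₗ[ℝ] (V →ₗ[ℝ] ℝ))
    (δ κ : V →ₗ[ℝ] V →ₗ[ℝ] V →ₗ[ℝ] ℝ) (η : V) (he : ∀ u w, e u w = e w u)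
    (hδ : ∀ X Y Z, δ X Y Z = δ X Z Y) (hκ : ∀ X Y Z, κ X Y Z = κ X Z Y)
    (hκ' : ∀ X Y, κ X Y η = 0) :
    ∃ B : V →ₗ[ℝ] V →ₗ[ℝ] V, (∀ X Y, B X Y = B Y X) ∧
      ∀ X Y Z, δ X Y Z = e (B X Y) Z + e Y (B X Z) + κ (B X η) Y Z := by
  -- The equation is implicit, because `B X η` occurs inside `κ`. It is solved in three stages: `κ`
  -- drops out of the Koszul formula for `B η η`, which is `c`; the one for `B X η`, which is `N X`,
  -- then involves only `c`; and the one for `B X Y` involves only `N`.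
  let c := e.symm (koszulForm δ η η)
  let N : V →ₗ[ℝ] V := e.symm.toLinearMap ∘ₗ ((koszulForm δ).flip η - (1 / 2 : ℝ) • κ c)
  let B : V →ₗ[ℝ] V →ₗ[ℝ] V :=
    (koszulForm δ - koszulForm (κ ∘ₗ N) : V →ₗ[ℝ] V →ₗ[ℝ] V →ₗ[ℝ] ℝ).compr₂ e.symm.toLinearMap
  have hN : ∀ X Z, e (N X) Z = koszulForm δ X η Z - 1 / 2 * κ c X Z := by
    intro X Z; simp [N]
  have hB : ∀ X Y Z, e (B X Y) Z = koszulForm δ X Y Z - koszulForm (κ ∘ₗ N) X Y Z := by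
    intro X Y Z; simp [B]
  have hκ'' : ∀ X Y, κ X η Y = 0 := fun X Y => by rw [hκ, hκ']
  have hNη : N η = c := by
    apply e.injective; ext Z
    rw [hN, hκ'']; simp [c]
  have hBη : ∀ X, B X η = N X := by
    intro X; apply e.injective; ext Z
    rw [hB, hN, koszulForm_apply (κ ∘ₗ N)]
    simp [hNη, hκ', hκ'']
  refine ⟨B, fun X Y => ?_, fun X Y Z => ?_⟩
  · apply e.injective; ext Z
    rw [hB, hB]; simp only [koszulForm_apply, LinearMap.comp_apply]
    rw [hδ Z X Y, hκ (N Z) X Y]; ring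
  · rw [hBη, he Y, hB, hB]; simp only [koszulForm_apply, LinearMap.comp_apply]
    rw [hδ X Z Y, hκ (N X) Z Y]; ring

end Koszul

/-! ### Existence and smoothness of the Levi-Civita-Chern connection. -/

namespace LocalMetric

variable {E : Type*} [NormedAddCommGroup E] [NormedSpace ℝ E] [FiniteDimensional ℝ E]
  {f : E × E → ℝ} {U : Set (E × E)} {q : E × E}

theorem isLeviCivitaChern_iff (h : LocalMetric f U) (hq : q ∈ U) (B : E →ₗ[ℝ] E →ₗ[ℝ] E) :
    IsLeviCivitaChern f q B ↔ (∀ X Y, B X Y = B Y X) ∧ ∀ X Y Z,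
      fderiv ℝ (metricForm f) q (X, 0) Y Z = metricForm f q (B X Y) Z + metricForm f q Y (B X Z)
        + fderiv ℝ (metricForm f) q (0, B X q.2) Y Z := by
  have key : ∀ X Y Z, deriv (fun t : ℝ => fundTensor f (q.1 + t • X, q.2) Y Z) 0
      = fderiv ℝ (metricForm f) q (X, 0) Y Z := by
    intro X Y Z
    have h1 : (fun t : ℝ => fundTensor f (q.1 + t • X, q.2) Y Z)
        =ᶠ[nhds 0] fun t : ℝ => metricForm f (q.1 + t • X, q.2) Y Z := by
      filter_upwards [h.eventually_mem_horizontal hq X] with t ht using h.fundTensor_eq ht Y Z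
    rw [h1.deriv_eq, deriv_horizontal (W := fun p => metricForm f p Y Z),
      h.fderiv_metricForm_apply hq]
    exact ((h.differentiableAt_metricForm hq).clm_apply (differentiableAt_const _)).clm_apply
      (differentiableAt_const _)
  constructor
  · rintro ⟨h1, h2⟩
    refine ⟨h1, fun X Y Z => ?_⟩
    rw [← key, h2, h.fundTensor_eq hq, h.fundTensor_eq hq, h.cartanTensor_eq hq]; ring
  · rintro ⟨h1, h2⟩
    refine ⟨h1, fun X Y Z => ?_⟩
    rw [key, h2, h.fundTensor_eq hq, h.fundTensor_eq hq, h.cartanTensor_eq hq]; ring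

theorem exists_isLeviCivitaChern (h : LocalMetric f U) (hq : q ∈ U) :
    ∃ B, IsLeviCivitaChern f q B := by
  obtain ⟨e, he⟩ := exists_continuousLinearEquiv_of_nondegenerate (metricForm f q)
    fun u hu => h.eq_zero_of_metricForm hq hu
  have he' : ∀ u w, e u w = metricForm f q u w := fun u w => by rw [← he]; rfl
  -- With `inl` this is the horizontal derivative `δ` of the metric, with `inr` the vertical
  -- derivative `κ`, which is twice the Cartan tensor.
  let tri : (E →L[ℝ] E × E) → (E →ₗ[ℝ] E →ₗ[ℝ] E →ₗ[ℝ] ℝ) := fun T =>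
    LinearMap.mk₂ ℝ (fun X Y => (fderiv ℝ (metricForm f) q (T X) Y : E →ₗ[ℝ] ℝ)) (by intros; ext; simp) (by intros; ext; simp)
      (by intros; ext; simp) (by intros; ext; simp)
  obtain ⟨B, hB1, hB2⟩ := exists_torsionFree_compatible
    (e.toLinearEquiv.trans LinearMap.toContinuousLinearMap.symm)
    (tri (ContinuousLinearMap.inl ℝ E E))
    (tri (ContinuousLinearMap.inr ℝ E E)) q.2
    (fun u w => (he' u w).trans ((h.metricForm_comm hq u w).trans (he' w u).symm))
    (fun X Y Z => h.fderiv_metricForm_comm hq _ Y Z)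
    (fun X Y Z => h.fderiv_metricForm_comm hq _ Y Z)
    (fun X Y => h.fderiv_metricForm_vertical_self hq X Y)
  refine ⟨B, (h.isLeviCivitaChern_iff hq B).2 ⟨hB1, fun X Y Z => ?_⟩⟩
  rw [← he', ← he']
  exact hB2 X Y Z

theorem chernSymbol_comm (h : LocalMetric f U) (hq : q ∈ U) (X Y : E) :
    chernSymbol f q X Y = chernSymbol f q Y X :=
  ((h.isLeviCivitaChern_iff hq _).1 (Classical.epsilon_spec (h.exists_isLeviCivitaChern hq))).1 X Y

theorem chernSymbol_compatible (h : LocalMetric f U) (hq : q ∈ U) (X Y Z : E) :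
    fderiv ℝ (metricForm f) q (X, 0) Y Z
      = metricForm f q (chernSymbol f q X Y) Z + metricForm f q Y (chernSymbol f q X Z)
        + fderiv ℝ (metricForm f) q (0, chernSymbol f q X q.2) Y Z :=
  ((h.isLeviCivitaChern_iff hq _).1 (Classical.epsilon_spec (h.exists_isLeviCivitaChern hq))).2 X Y Z

/-- The Koszul formula for the Levi-Civita-Chern connection. -/
theorem metricForm_chernSymbol (h : LocalMetric f U) (hq : q ∈ U) (X Y Z : E) :
    metricForm f q (chernSymbol f q X Y) Z = 1 / 2 *
      ((fderiv ℝ (metricForm f) q (X, 0) Y Z + fderiv ℝ (metricForm f) q (Y, 0) X Z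
          - fderiv ℝ (metricForm f) q (Z, 0) X Y)
        - (fderiv ℝ (metricForm f) q (0, chernSymbol f q X q.2) Y Z
          + fderiv ℝ (metricForm f) q (0, chernSymbol f q Y q.2) X Z
          - fderiv ℝ (metricForm f) q (0, chernSymbol f q Z q.2) X Y)) := by
  rw [h.chernSymbol_compatible hq X, h.chernSymbol_compatible hq Y, h.chernSymbol_compatible hq Z,
    h.chernSymbol_comm hq Y X, h.chernSymbol_comm hq Z X, h.chernSymbol_comm hq Z Y,
    h.metricForm_comm hq Y, h.metricForm_comm hq X]
  ring

theorem contDiffOn_fderiv_metricForm (h : LocalMetric f U) {r : E × E → E × E} {X Y : E × E → E}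
    (hr : ContDiffOn ℝ ∞ r U) (hX : ContDiffOn ℝ ∞ X U) (hY : ContDiffOn ℝ ∞ Y U) :
    ContDiffOn ℝ ∞ (fun p => fderiv ℝ (metricForm f) p (r p) (X p) (Y p)) U := by
  have hD : ContDiffOn ℝ ∞ (fderiv ℝ (metricForm f)) U := fun p hp =>
    ((h.contDiffAt_metricForm hp).fderiv_right (m := ∞) (by simp)).contDiffWithinAt
  exact ((hD.clm_apply hr).clm_apply hX).clm_apply hY

theorem contDiffOn_metricForm (h : LocalMetric f U) : ContDiffOn ℝ ∞ (metricForm f) U :=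
  fun _ hp => (h.contDiffAt_metricForm hp).contDiffWithinAt

/-- The Koszul formula contains the symbols on both sides, so smoothness is bootstrapped in the same
order as existence: first `Γ(v, v)`, then `Γ(X, v)`, then `Γ(X, Y)`. Each right-hand side uses only
symbols already known to be smooth. -/
theorem contDiffOn_chernSymbol (h : LocalMetric f U) (X Y : E) :
    ContDiffOn ℝ ∞ (fun p => chernSymbol f p X Y) U := by
  have base : ∀ {W : E × E → E}, (∀ z, ContDiffOn ℝ ∞ (fun p => metricForm f p (W p) z) U) →
      ContDiffOn ℝ ∞ W U := fun hW =>
    contDiffOn_of_nondegenerate h.isOpen h.contDiffOn_metricForm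
      (fun p hp u hu => h.eq_zero_of_metricForm hp hu) hW
  have hc : ∀ {Z : E}, ContDiffOn ℝ ∞ (fun _ : E × E => Z) U := contDiffOn_const
  have hs : ContDiffOn ℝ ∞ (fun p : E × E => p.2) U := contDiffOn_snd
  have h0 : ContDiffOn ℝ ∞ (fun p => chernSymbol f p p.2 p.2) U := by
    refine base fun z => ContDiffOn.congr (f := fun p => 1 / 2 *
      (fderiv ℝ (metricForm f) p (p.2, 0) p.2 z + fderiv ℝ (metricForm f) p (p.2, 0) p.2 z
        - fderiv ℝ (metricForm f) p (z, 0) p.2 p.2)) ?_ fun p hp => ?_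
    · exact contDiffOn_const.mul (((h.contDiffOn_fderiv_metricForm (hs.prodMk hc) hs hc).add
        (h.contDiffOn_fderiv_metricForm (hs.prodMk hc) hs hc)).sub
        (h.contDiffOn_fderiv_metricForm (hc.prodMk hc) hs hs))
    · rw [h.metricForm_chernSymbol hp]
      simp [h.fderiv_metricForm_vertical_self hp, h.fderiv_metricForm_vertical_self_left hp]
  have h1 : ∀ X, ContDiffOn ℝ ∞ (fun p => chernSymbol f p X p.2) U := by
    intro X
    refine base fun z => ContDiffOn.congr (f := fun p => 1 / 2 *
      ((fderiv ℝ (metricForm f) p (X, 0) p.2 z + fderiv ℝ (metricForm f) p (p.2, 0) X z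
        - fderiv ℝ (metricForm f) p (z, 0) X p.2)
        - fderiv ℝ (metricForm f) p (0, chernSymbol f p p.2 p.2) X z)) ?_ fun p hp => ?_
    · exact contDiffOn_const.mul ((((h.contDiffOn_fderiv_metricForm (hc.prodMk hc) hs hc).add
        (h.contDiffOn_fderiv_metricForm (hs.prodMk hc) hc hc)).sub
        (h.contDiffOn_fderiv_metricForm (hc.prodMk hc) hc hs)).sub
        (h.contDiffOn_fderiv_metricForm (hc.prodMk h0) hc hc))
    · rw [h.metricForm_chernSymbol hp]
      simp [h.fderiv_metricForm_vertical_self hp, h.fderiv_metricForm_vertical_self_left hp]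
  refine base fun z => ContDiffOn.congr ?_ fun p hp => h.metricForm_chernSymbol hp X Y z
  exact contDiffOn_const.mul ((((h.contDiffOn_fderiv_metricForm (hc.prodMk hc) hc hc).add
    (h.contDiffOn_fderiv_metricForm (hc.prodMk hc) hc hc)).sub
    (h.contDiffOn_fderiv_metricForm (hc.prodMk hc) hc hc)).sub
    (((h.contDiffOn_fderiv_metricForm (hc.prodMk (h1 X)) hc hc).add
    (h.contDiffOn_fderiv_metricForm (hc.prodMk (h1 Y)) hc hc)).sub
    (h.contDiffOn_fderiv_metricForm (hc.prodMk (h1 z)) hc hc)))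

end LocalMetric

/-! ### Curvature, vertical derivative and parallelism of the metric. -/

section

variable {E : Type*} [NormedAddCommGroup E] [NormedSpace ℝ E] [FiniteDimensional ℝ E]

/-- The Levi-Civita-Chern connection of `f`, as a field of Christoffel symbols. -/
abbrev chernConnection {E : Type*} [NormedAddCommGroup E] [NormedSpace ℝ E] (f : E × E → ℝ) :
    E × E → E → E → E :=
  fun q X Y => chernSymbol f q X Y

/-- The Christoffel symbols as a continuous bilinear map. -/
def chernMap (f : E × E → ℝ) (q : E × E) : E →L[ℝ] E →L[ℝ] E :=
  (chernSymbol f q).toContinuousBilinearMap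

theorem chernMap_apply (f : E × E → ℝ) (q : E × E) (X Y : E) :
    chernMap f q X Y = chernSymbol f q X Y := rfl

namespace LocalMetric

variable {f : E × E → ℝ} {U : Set (E × E)} {q : E × E}

theorem contDiffAt_chernMap (h : LocalMetric f U) (hq : q ∈ U) : ContDiffAt ℝ ∞ (chernMap f) q :=
  (contDiffOn_clm_apply.2 fun X => contDiffOn_clm_apply.2 fun Y =>
    h.contDiffOn_chernSymbol X Y : ContDiffOn ℝ ∞ (chernMap f) U).contDiffAt (h.isOpen.mem_nhds hq)

theorem differentiableAt_chernMap (h : LocalMetric f U) (hq : q ∈ U) :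
    DifferentiableAt ℝ (chernMap f) q :=
  (h.contDiffAt_chernMap hq).differentiableAt (by simp)

theorem differentiableAt_chernSymbol (h : LocalMetric f U) (hq : q ∈ U) (X Y : E) :
    DifferentiableAt ℝ (fun p => chernSymbol f p X Y) q :=
  ((h.contDiffOn_chernSymbol X Y).contDiffAt (h.isOpen.mem_nhds hq)).differentiableAt (by simp)

theorem fderiv_chernMap_apply (h : LocalMetric f U) (hq : q ∈ U) (r : E × E) (X Y : E) :
    fderiv ℝ (chernMap f) q r X Y = fderiv ℝ (fun p => chernSymbol f p X Y) q r := by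
  have h1 := h.differentiableAt_chernMap hq
  change _ = fderiv ℝ (fun p => chernMap f p X Y) q r
  rw [fderiv_clm_apply (h1.clm_apply (differentiableAt_const _)) (differentiableAt_const _),
    fderiv_clm_apply h1 (differentiableAt_const _)]
  simp

theorem vertDeriv_chernConnection (h : LocalMetric f U) (hq : q ∈ U) (X Y z : E) :
    vertDeriv (chernConnection f) q X Y z = fderiv ℝ (chernMap f) q (0, z) X Y := by
  rw [h.fderiv_chernMap_apply hq]
  exact deriv_vertical (h.differentiableAt_chernSymbol hq X Y) z

theorem curvature_chernConnection (h : LocalMetric f U) (hq : q ∈ U) (X Y Z : E) :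
    curvature (chernConnection f) q X Y Z
      = (fderiv ℝ (chernMap f) q (X, -chernSymbol f q X q.2) Y Z
          + chernSymbol f q X (chernSymbol f q Y Z))
        - (fderiv ℝ (chernMap f) q (Y, -chernSymbol f q Y q.2) X Z
          + chernSymbol f q Y (chernSymbol f q X Z)) := by
  rw [curvature, covDerivField_eq _ _ (h.differentiableAt_chernSymbol hq Y Z),
    covDerivField_eq _ _ (h.differentiableAt_chernSymbol hq X Z), h.fderiv_chernMap_apply hq,
    h.fderiv_chernMap_apply hq]

/-- The fundamental tensor is parallel along horizontal directions. -/
theorem fderiv_metricForm_horizontal (h : LocalMetric f U) (hq : q ∈ U) (X Y Z : E) :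
    fderiv ℝ (metricForm f) q (X, -chernSymbol f q X q.2) Y Z
      = metricForm f q (chernSymbol f q X Y) Z + metricForm f q Y (chernSymbol f q X Z) := by
  have h1 : (X, -chernSymbol f q X q.2) = (X, (0 : E)) - (0, chernSymbol f q X q.2) := by simp
  rw [h1, map_sub]
  simp only [sub_apply]
  rw [h.chernSymbol_compatible hq]
  ring

theorem fderiv_metricForm_mul_self (h : LocalMetric f U) (hq : q ∈ U) {W : E × E → E}
    (hW : DifferentiableAt ℝ W q) (r : E × E) :
    fderiv ℝ (fun p => metricForm f p (W p) p.2) q r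
      = fderiv ℝ (metricForm f) q r (W q) q.2 + metricForm f q (fderiv ℝ W q r) q.2
        + metricForm f q (W q) r.2 := by
  have hG := h.differentiableAt_metricForm hq
  rw [fderiv_clm_apply (hG.clm_apply hW) differentiableAt_snd, fderiv_clm_apply hG hW]
  simp [fderiv_snd]
  ring

theorem fderiv_metricForm_mul_self_horizontal (h : LocalMetric f U) (hq : q ∈ U) {W : E × E → E}
    (hW : DifferentiableAt ℝ W q) (X : E) :
    fderiv ℝ (fun p => metricForm f p (W p) p.2) q (X, -chernSymbol f q X q.2)
      = metricForm f q (covDerivField (chernConnection f) X W q) q.2 := by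
  rw [h.fderiv_metricForm_mul_self hq hW, h.fderiv_metricForm_horizontal hq,
    covDerivField_eq _ _ hW]
  simp
  ring

/-- The metric is constant along horizontal directions. -/
theorem fderiv_horizontal (h : LocalMetric f U) (hq : q ∈ U) (X : E) :
    fderiv ℝ f q (X, -chernSymbol f q X q.2) = 0 := by
  have h1 : f =ᶠ[nhds q] fun p => metricForm f p p.2 p.2 := by
    filter_upwards [h.isOpen.mem_nhds hq] with p hp using (h.metricForm_self_self hp).symm
  rw [h1.fderiv_eq, h.fderiv_metricForm_mul_self_horizontal hq (W := Prod.snd) differentiableAt_snd,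
    covDerivField_eq _ _ differentiableAt_snd]
  simp [fderiv_snd]

/-- The reason is that `f` is constant along horizontal vectors. Differentiating that identity
vertically gives a mixed second derivative of `f`, a term in `Γ X z` and the wanted term. Horizontal
differentiation of `g_v(z, v) = ½ Df(0, z)` shows that the first two cancel. -/
theorem metricForm_fderiv_chernMap_self (h : LocalMetric f U) (hq : q ∈ U) (X z : E) :
    metricForm f q (fderiv ℝ (chernMap f) q (0, z) X q.2) q.2 = 0 := by
  have hd := (h.contDiffAt_fderiv hq).differentiableAt (by simp)
  have hΓ := h.differentiableAt_chernMap hq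
  have h1 : (fun p : E × E => fderiv ℝ f p (X, -chernMap f p X p.2)) =ᶠ[nhds q] fun _ => 0 := by
    filter_upwards [h.isOpen.mem_nhds hq] with p hp using h.fderiv_horizontal hp X
  have hN : DifferentiableAt ℝ (fun p : E × E => chernMap f p X p.2) q :=
    (hΓ.clm_apply (differentiableAt_const _)).clm_apply differentiableAt_snd
  have h2 := DFunLike.congr_fun (h1.fderiv_eq (𝕜 := ℝ)) (0, z)
  rw [fderiv_clm_apply hd ((differentiableAt_const _).prodMk hN.fun_neg),
    DifferentiableAt.fderiv_prodMk (differentiableAt_const _) hN.fun_neg, fderiv_fun_neg,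
    fderiv_clm_apply (hΓ.clm_apply (differentiableAt_const _)) differentiableAt_snd,
    fderiv_clm_apply hΓ (differentiableAt_const _)] at h2
  simp [fderiv_snd] at h2
  have h3 : (fun p : E × E => metricForm f p z p.2) =ᶠ[nhds q]
      fun p => 1 / 2 * fderiv ℝ f p (0, z) := by
    filter_upwards [h.isOpen.mem_nhds hq] with p hp using h.metricForm_self_right hp z
  have h4 := h.fderiv_metricForm_mul_self_horizontal hq (W := fun _ => z)
    (differentiableAt_const _) X
  rw [h3.fderiv_eq, fderiv_const_mul (hd.clm_apply (differentiableAt_const _)),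
    fderiv_clm_apply hd (differentiableAt_const _),
    covDerivField_eq _ _ (differentiableAt_const _)] at h4
  simp at h4
  have h5 := ((h.contDiffAt hq).isSymmSndFDerivAt minSmoothness_two_le).eq (0, z)
    (X, -chernSymbol f q X q.2)
  have h6 := h.metricForm_self_right hq (fderiv ℝ (chernMap f) q (0, z) X q.2)
  have h7 := h.metricForm_self_right hq (chernSymbol f q X z)
  have h8 : ∀ a b : E, fderiv ℝ f q (0, -a + -b) = -fderiv ℝ f q (0, a) - fderiv ℝ f q (0, b) := by
    intro a b
    rw [← map_neg, ← map_sub]; simp [sub_eq_add_neg]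
  simp only [chernMap_apply] at h2
  rw [h8] at h2
  linarith

end LocalMetric

end

/-! ### Immersions: tangent part, second fundamental form and difference tensor. -/

section

/-- Linearity is known only on `s`, so the bundled map is set to zero wherever it fails. Bundling is
needed for the product rule when the argument of the tensor moves with the point. -/
theorem exists_contDiffOn_clm {P E F : Type*} [NormedAddCommGroup P] [NormedSpace ℝ P]
    [NormedAddCommGroup E] [NormedSpace ℝ E] [FiniteDimensional ℝ E]
    [NormedAddCommGroup F] [NormedSpace ℝ F] {n : WithTop ℕ∞} {s : Set P} {T : P → E → F}
    (hlin : ∀ p ∈ s, IsLinearMap ℝ (T p)) (hT : ∀ a, ContDiffOn ℝ n (fun p => T p a) s) :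
    ∃ L : P → E →L[ℝ] F, ContDiffOn ℝ n L s ∧ ∀ p ∈ s, ∀ a, L p a = T p a := by
  classical
  let L : P → E →L[ℝ] F := fun p =>
    if h : IsLinearMap ℝ (T p) then (h.mk' (T p)).toContinuousLinearMap else 0
  have hL : ∀ p ∈ s, ∀ a, L p a = T p a := fun p hp a => by
    simp only [L, dif_pos (hlin p hp)]; rfl
  exact ⟨L, contDiffOn_clm_apply.2 fun a => (hT a).congr fun p hp => hL p hp a, hL⟩

variable {E : Type*} [NormedAddCommGroup E] [NormedSpace ℝ E]
  {E' : Type*} [NormedAddCommGroup E'] [NormedSpace ℝ E']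

/-- `φ` is, over `U'`, an immersion of coordinate domains which induces the metric `f'` on `U'` from
the metric `f` on `U`. -/
structure LocalImmersion (f : E × E → ℝ) (U : Set (E × E)) (φ : E' → E) (f' : E' × E' → ℝ)
    (U' : Set (E' × E')) : Prop where
  ambient : LocalMetric f U
  induced : LocalMetric f' U'
  contDiffAt : ∀ q ∈ U', ContDiffAt ℝ ∞ φ q.1
  mapsTo : ∀ q ∈ U', push φ q ∈ U
  comp : ∀ q ∈ U', ∀ z, f' (q.1, z) = f (push φ (q.1, z))

namespace LocalImmersion

variable {f : E × E → ℝ} {U : Set (E × E)} {φ : E' → E} {f' : E' × E' → ℝ}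
  {U' : Set (E' × E')} {q : E' × E'}

theorem contDiffAt_fderiv (h : LocalImmersion f U φ f' U') (hq : q ∈ U') :
    ContDiffAt ℝ ∞ (fderiv ℝ φ) q.1 :=
  (h.contDiffAt q hq).fderiv_right (by simp)

theorem contDiffAt_fderiv_fderiv (h : LocalImmersion f U φ f' U') (hq : q ∈ U') :
    ContDiffAt ℝ ∞ (fderiv ℝ (fderiv ℝ φ)) q.1 :=
  (h.contDiffAt_fderiv hq).fderiv_right (by simp)

theorem contDiffAt_fderiv_fst (h : LocalImmersion f U φ f' U') (hq : q ∈ U') :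
    ContDiffAt ℝ ∞ (fun p : E' × E' => fderiv ℝ φ p.1) q :=
  ContDiffAt.comp (g := fderiv ℝ φ) q (h.contDiffAt_fderiv hq) contDiffAt_fst

theorem contDiffAt_fderiv_fderiv_fst (h : LocalImmersion f U φ f' U') (hq : q ∈ U') :
    ContDiffAt ℝ ∞ (fun p : E' × E' => fderiv ℝ (fderiv ℝ φ) p.1) q :=
  ContDiffAt.comp (g := fderiv ℝ (fderiv ℝ φ)) q (h.contDiffAt_fderiv_fderiv hq) contDiffAt_fst

theorem contDiffAt_push (h : LocalImmersion f U φ f' U') (hq : q ∈ U') :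
    ContDiffAt ℝ ∞ (push φ) q :=
  (ContDiffAt.comp (g := φ) q (h.contDiffAt q hq) contDiffAt_fst).prodMk
    ((h.contDiffAt_fderiv_fst hq).clm_apply contDiffAt_snd)

theorem differentiableAt_fderiv (h : LocalImmersion f U φ f' U') (hq : q ∈ U') :
    DifferentiableAt ℝ (fderiv ℝ φ) q.1 :=
  (h.contDiffAt_fderiv hq).differentiableAt (by simp)

theorem fderiv_fderiv_fst (h : LocalImmersion f U φ f' U') (hq : q ∈ U') (r : E' × E') :
    fderiv ℝ (fun p : E' × E' => fderiv ℝ φ p.1) q r = fderiv ℝ (fderiv ℝ φ) q.1 r.1 := by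
  have h1 := (h.differentiableAt_fderiv hq).hasFDerivAt.comp q (hasFDerivAt_fst (p := q))
  change fderiv ℝ (fderiv ℝ φ ∘ Prod.fst) q r = _
  rw [h1.fderiv]; rfl

theorem fderiv_fderiv_fst_apply (h : LocalImmersion f U φ f' U') (hq : q ∈ U') (r : E' × E')
    (b : E') : fderiv ℝ (fun p : E' × E' => fderiv ℝ φ p.1 b) q r
      = fderiv ℝ (fderiv ℝ φ) q.1 r.1 b := by
  rw [fderiv_clm_apply ((h.contDiffAt_fderiv_fst hq).differentiableAt (by simp))
    (differentiableAt_const _)]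
  simp [h.fderiv_fderiv_fst hq]

theorem fderiv_push (h : LocalImmersion f U φ f' U') (hq : q ∈ U') (r : E' × E') :
    fderiv ℝ (push φ) q r
      = (fderiv ℝ φ q.1 r.1, fderiv ℝ (fderiv ℝ φ) q.1 r.1 q.2 + fderiv ℝ φ q.1 r.2) := by
  have h0 := ((h.contDiffAt q hq).differentiableAt (by simp)).hasFDerivAt.comp q
    (hasFDerivAt_fst (p := q))
  have h1 := (h.contDiffAt_fderiv_fst hq).differentiableAt (by simp)
  change fderiv ℝ (fun p : E' × E' => ((φ ∘ Prod.fst) p, fderiv ℝ φ p.1 p.2)) q r = _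
  rw [DifferentiableAt.fderiv_prodMk h0.differentiableAt (h1.clm_apply differentiableAt_snd),
    h0.fderiv, fderiv_clm_apply h1 differentiableAt_snd]
  simp [fderiv_snd, h.fderiv_fderiv_fst hq, add_comm]

theorem metricForm_induced (h : LocalImmersion f U φ f' U') (hq : q ∈ U') (a b : E') :
    metricForm f' q a b = metricForm f (push φ q) (fderiv ℝ φ q.1 a) (fderiv ℝ φ q.1 b) := by
  rw [← h.induced.fundTensor_eq hq, ← h.ambient.fundTensor_eq (h.mapsTo q hq)]
  unfold fundTensor
  rw [funext fun z => h.comp q hq z]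
  exact PseudoFinslerMetric.fundForm_comp_linear (fderiv ℝ φ q.1).toLinearMap
    (fun z => f (φ q.1, z)) q.2 a b

theorem ambientDeriv_eq (h : LocalImmersion f U φ f' U') (hq : q ∈ U') (a b : E') :
    ambientDeriv φ (chernConnection f) q a b = fderiv ℝ (fderiv ℝ φ) q.1 a b
      + chernSymbol f (push φ q) (fderiv ℝ φ q.1 a) (fderiv ℝ φ q.1 b) := by
  have h1 := (h.differentiableAt_fderiv hq).clm_apply (differentiableAt_const b)
  rw [ambientDeriv, (hasDerivAt_line (W := fun y => fderiv ℝ φ y b) h1 a).deriv,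
    fderiv_clm_apply (h.differentiableAt_fderiv hq) (differentiableAt_const _)]
  simp

theorem fderiv_fderiv_comm (h : LocalImmersion f U φ f' U') (hq : q ∈ U') (a b : E') :
    fderiv ℝ (fderiv ℝ φ) q.1 a b = fderiv ℝ (fderiv ℝ φ) q.1 b a :=
  ((h.contDiffAt q hq).isSymmSndFDerivAt minSmoothness_two_le).eq a b

theorem eventually_mem (h : LocalImmersion f U φ f' U') (hq : q ∈ U') : ∀ᶠ p in nhds q, p ∈ U' :=
  h.induced.isOpen.mem_nhds hq

theorem eq_of_metricForm (h : LocalImmersion f U φ f' U') (hq : q ∈ U') {a b : E'}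
    (hab : ∀ z, metricForm f' q a z = metricForm f' q b z) : a = b :=
  sub_eq_zero.1 <| h.induced.eq_zero_of_metricForm hq fun z => by
    rw [map_sub, sub_apply, hab, sub_self]

theorem ambientDeriv_decomp (f : E × E → ℝ) (φ : E' → E) (f' : E' × E' → ℝ) (q : E' × E')
    (a b : E') : ambientDeriv φ (chernConnection f) q a b
      = fderiv ℝ φ q.1 (chernSymbol f' q a b + differenceTensor f φ f' q a b)
        + secondForm f φ q a b := by
  simp [differenceTensor, secondForm]

theorem exists_tangent [FiniteDimensional ℝ E'] (h : LocalImmersion f U φ f' U') (hq : q ∈ U') (w : E) :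
    ∃ t : E', ∀ z : E',
      fundTensor f (push φ q) (w - fderiv ℝ φ q.1 t) (fderiv ℝ φ q.1 z) = 0 := by
  obtain ⟨e, he⟩ := exists_continuousLinearEquiv_of_nondegenerate (metricForm f' q)
    fun u hu => h.induced.eq_zero_of_metricForm hq hu
  have he' : ∀ u z, e u z = metricForm f' q u z := fun u z => by rw [← he]; rfl
  -- The tangent part represents the functional `z ↦ g(w, dφ z)` through the induced form, which is
  -- nondegenerate.
  refine ⟨e.symm ((metricForm f (push φ q) w).comp (fderiv ℝ φ q.1)), fun z => ?_⟩
  rw [h.ambient.fundTensor_eq (h.mapsTo q hq), map_sub, sub_apply,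
    ← h.metricForm_induced hq, ← he']
  simp

theorem metricForm_tangentPart [FiniteDimensional ℝ E'] (h : LocalImmersion f U φ f' U') (hq : q ∈ U') (w : E) (z : E') :
    metricForm f' q (tangentPart f φ q w) z = metricForm f (push φ q) w (fderiv ℝ φ q.1 z) := by
  have h1 := Classical.epsilon_spec (h.exists_tangent hq w) z
  rw [h.ambient.fundTensor_eq (h.mapsTo q hq), map_sub, sub_apply,
    ← h.metricForm_induced hq] at h1
  rw [tangentPart]
  linarith

theorem metricForm_inducedSymbol [FiniteDimensional ℝ E'] (h : LocalImmersion f U φ f' U') (hq : q ∈ U') (a b z : E') :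
    metricForm f' q (inducedSymbol f φ q a b) z
      = metricForm f (push φ q) (ambientDeriv φ (chernConnection f) q a b) (fderiv ℝ φ q.1 z) :=
  h.metricForm_tangentPart hq _ z

theorem metricForm_secondForm [FiniteDimensional ℝ E'] (h : LocalImmersion f U φ f' U') (hq : q ∈ U') (a b z : E') :
    metricForm f (push φ q) (secondForm f φ q a b) (fderiv ℝ φ q.1 z) = 0 := by
  rw [secondForm, map_sub, sub_apply, ← h.metricForm_induced hq,
    h.metricForm_inducedSymbol hq, sub_self]

/-- The tangent part is an arbitrary choice by definition; nondegeneracy of the induced metric makes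
it unique, and hence linear. -/
theorem isLinearMap_inducedSymbol [FiniteDimensional ℝ E'] (h : LocalImmersion f U φ f' U') (hq : q ∈ U')
    (b : E') :
    IsLinearMap ℝ (fun a => inducedSymbol f φ q a b) where
  map_add a c := h.eq_of_metricForm hq fun z => by
    simp only [map_add, add_apply, LinearMap.add_apply, h.metricForm_inducedSymbol hq,
      h.ambientDeriv_eq hq]
    ring
  map_smul a c := h.eq_of_metricForm hq fun z => by
    simp only [map_smul, smul_apply, map_add, add_apply, h.metricForm_inducedSymbol hq,
      h.ambientDeriv_eq hq, LinearMap.smul_apply, smul_eq_mul]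
    ring

theorem isLinearMap_differenceTensor [FiniteDimensional ℝ E'] (h : LocalImmersion f U φ f' U') (hq : q ∈ U')
    (b : E') :
    IsLinearMap ℝ (fun a => differenceTensor f φ f' q a b) where
  map_add a c := by
    simp only [differenceTensor, (h.isLinearMap_inducedSymbol hq b).map_add a c, map_add,
      LinearMap.add_apply]
    abel
  map_smul a c := by
    simp only [differenceTensor, (h.isLinearMap_inducedSymbol hq b).map_smul a c, map_smul,
      LinearMap.smul_apply, smul_sub]

/-- The derivative of `push φ` in a direction horizontal for the induced metric is horizontal for
the ambient metric up to a vertical vector. -/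
theorem fderiv_push_horizontal (h : LocalImmersion f U φ f' U') (hq : q ∈ U') (a : E') :
    fderiv ℝ (push φ) q (a, -chernSymbol f' q a q.2)
      = (fderiv ℝ φ q.1 a,
          -chernSymbol f (push φ q) (fderiv ℝ φ q.1 a) (push φ q).2)
        + (0, fderiv ℝ φ q.1 (differenceTensor f φ f' q a q.2) + secondForm f φ q a q.2) := by
  have h1 := h.ambientDeriv_eq hq a q.2
  rw [ambientDeriv_decomp f φ f', map_add] at h1
  have h2 : (push φ q).2 = fderiv ℝ φ q.1 q.2 := rfl
  rw [h.fderiv_push hq, h2]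
  ext
  · simp
  · simp only [Prod.snd_add, map_neg]
    rw [← sub_eq_iff_eq_add'.2 h1]
    abel

variable [FiniteDimensional ℝ E]

theorem ambientDeriv_comm (h : LocalImmersion f U φ f' U') (hq : q ∈ U') (a b : E') :
    ambientDeriv φ (chernConnection f) q a b = ambientDeriv φ (chernConnection f) q b a := by
  rw [h.ambientDeriv_eq hq, h.ambientDeriv_eq hq, h.fderiv_fderiv_comm hq,
    h.ambient.chernSymbol_comm (h.mapsTo q hq)]

theorem inducedSymbol_comm (h : LocalImmersion f U φ f' U') (hq : q ∈ U') (a b : E') :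
    inducedSymbol f φ q a b = inducedSymbol f φ q b a := by
  rw [inducedSymbol, inducedSymbol]
  exact congrArg _ (h.ambientDeriv_comm hq a b)

theorem secondForm_comm (h : LocalImmersion f U φ f' U') (hq : q ∈ U') (a b : E') :
    secondForm f φ q a b = secondForm f φ q b a := by
  rw [secondForm, secondForm, h.inducedSymbol_comm hq a b]
  exact congrArg (· - _) (h.ambientDeriv_comm hq a b)

theorem contDiffAt_chernMap_push (h : LocalImmersion f U φ f' U') (hq : q ∈ U') :
    ContDiffAt ℝ ∞ (fun p => chernMap f (push φ p)) q :=
  ContDiffAt.comp (g := chernMap f) q (h.ambient.contDiffAt_chernMap (h.mapsTo q hq))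
    (h.contDiffAt_push hq)

theorem contDiffAt_metricForm_push (h : LocalImmersion f U φ f' U') (hq : q ∈ U') :
    ContDiffAt ℝ ∞ (fun p => metricForm f (push φ p)) q :=
  ContDiffAt.comp (g := metricForm f) q (h.ambient.contDiffAt_metricForm (h.mapsTo q hq))
    (h.contDiffAt_push hq)

theorem contDiffAt_ambientDeriv (h : LocalImmersion f U φ f' U') (hq : q ∈ U') (a b : E') :
    ContDiffAt ℝ ∞ (fun p => ambientDeriv φ (chernConnection f) p a b) q := by
  refine ContDiffAt.congr_of_eventuallyEq (f := fun p : E' × E' => fderiv ℝ (fderiv ℝ φ) p.1 a b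
    + chernMap f (push φ p) (fderiv ℝ φ p.1 a) (fderiv ℝ φ p.1 b)) ?_ ?_
  · have h1 := h.contDiffAt_fderiv_fst hq
    exact (((h.contDiffAt_fderiv_fderiv_fst hq).clm_apply contDiffAt_const).clm_apply
      contDiffAt_const).add (((h.contDiffAt_chernMap_push hq).clm_apply
      (h1.clm_apply contDiffAt_const)).clm_apply (h1.clm_apply contDiffAt_const))
  · filter_upwards [h.eventually_mem hq] with p hp using h.ambientDeriv_eq hp a b

variable [FiniteDimensional ℝ E']

theorem contDiffOn_inducedSymbol (h : LocalImmersion f U φ f' U') (a b : E') :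
    ContDiffOn ℝ ∞ (fun p => inducedSymbol f φ p a b) U' := by
  refine contDiffOn_of_nondegenerate h.induced.isOpen h.induced.contDiffOn_metricForm
    (fun p hp u hu => h.induced.eq_zero_of_metricForm hp hu) fun z => ?_
  refine ContDiffOn.congr (fun p hp => ?_) fun p hp => h.metricForm_inducedSymbol hp a b z
  exact (((h.contDiffAt_metricForm_push hp).clm_apply (h.contDiffAt_ambientDeriv hp a b)).clm_apply
    ((h.contDiffAt_fderiv_fst hp).clm_apply contDiffAt_const)).contDiffWithinAt

theorem differenceTensor_comm (h : LocalImmersion f U φ f' U') (hq : q ∈ U') (a b : E') :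
    differenceTensor f φ f' q a b = differenceTensor f φ f' q b a := by
  rw [differenceTensor, differenceTensor, h.inducedSymbol_comm hq, h.induced.chernSymbol_comm hq]

theorem contDiffOn_differenceTensor (h : LocalImmersion f U φ f' U') (a b : E') :
    ContDiffOn ℝ ∞ (fun p => differenceTensor f φ f' p a b) U' :=
  (h.contDiffOn_inducedSymbol a b).sub (h.induced.contDiffOn_chernSymbol a b)

theorem differentiableAt_differenceTensor (h : LocalImmersion f U φ f' U') (hq : q ∈ U')
    (a b : E') : DifferentiableAt ℝ (fun p => differenceTensor f φ f' p a b) q :=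
  ((h.contDiffOn_differenceTensor a b).contDiffAt (h.induced.isOpen.mem_nhds hq)).differentiableAt
    (by simp)

end LocalImmersion

end

/-! ### Ambient curvature and compatibility along the submanifold. -/

namespace LocalImmersion

variable {E : Type*} [NormedAddCommGroup E] [NormedSpace ℝ E] [FiniteDimensional ℝ E]
  {E' : Type*} [NormedAddCommGroup E'] [NormedSpace ℝ E']
  {f : E × E → ℝ} {U : Set (E × E)} {φ : E' → E} {f' : E' × E' → ℝ}
  {U' : Set (E' × E')} {q : E' × E'}

/-- The chain rule, with the image of the horizontal vector split into its ambient horizontal part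
and a vertical error. The error is what creates the `vertDeriv` term. -/
theorem fderiv_ambientDeriv_horizontal (h : LocalImmersion f U φ f' U') (hq : q ∈ U')
    (a b c : E') :
    fderiv ℝ (fun p => ambientDeriv φ (chernConnection f) p b c) q (a, -chernSymbol f' q a q.2)
      = fderiv ℝ (fderiv ℝ (fderiv ℝ φ)) q.1 a b c
        + (fderiv ℝ (chernMap f) (push φ q) (fderiv ℝ φ q.1 a,
              -chernSymbol f (push φ q) (fderiv ℝ φ q.1 a) (push φ q).2)
            (fderiv ℝ φ q.1 b) (fderiv ℝ φ q.1 c)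
          + vertDeriv (chernConnection f) (push φ q) (fderiv ℝ φ q.1 b) (fderiv ℝ φ q.1 c)
            (fderiv ℝ φ q.1 (differenceTensor f φ f' q a q.2) + secondForm f φ q a q.2))
        + chernSymbol f (push φ q) (fderiv ℝ (fderiv ℝ φ) q.1 a b) (fderiv ℝ φ q.1 c)
        + chernSymbol f (push φ q) (fderiv ℝ φ q.1 b) (fderiv ℝ (fderiv ℝ φ) q.1 a c) := by
  have hev : (fun p => ambientDeriv φ (chernConnection f) p b c) =ᶠ[nhds q]
      fun p : E' × E' => fderiv ℝ (fderiv ℝ φ) p.1 b c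
        + chernMap f (push φ p) (fderiv ℝ φ p.1 b) (fderiv ℝ φ p.1 c) := by
    filter_upwards [h.eventually_mem hq] with p hp using h.ambientDeriv_eq hp b c
  have h1 : DifferentiableAt ℝ (fun p : E' × E' => fderiv ℝ φ p.1) q :=
    (h.contDiffAt_fderiv_fst hq).differentiableAt (by simp)
  have hb : ∀ b, DifferentiableAt ℝ (fun p : E' × E' => fderiv ℝ φ p.1 b) q :=
    fun b => h1.clm_apply (differentiableAt_const _)
  have h2 : DifferentiableAt ℝ (fun p : E' × E' => fderiv ℝ (fderiv ℝ φ) p.1) q :=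
    (h.contDiffAt_fderiv_fderiv_fst hq).differentiableAt (by simp)
  have h3 : DifferentiableAt ℝ (fun p => chernMap f (push φ p)) q :=
    (h.contDiffAt_chernMap_push hq).differentiableAt (by simp)
  have h4 := ((h.contDiffAt_fderiv_fderiv hq).differentiableAt (by simp)).hasFDerivAt.comp q
    (hasFDerivAt_fst (p := q))
  have h5 := (h.ambient.differentiableAt_chernMap (h.mapsTo q hq)).hasFDerivAt.comp q
    ((h.contDiffAt_push hq).differentiableAt (by simp)).hasFDerivAt
  have h4' : fderiv ℝ (fun p : E' × E' => fderiv ℝ (fderiv ℝ φ) p.1) q = _ := h4.fderiv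
  have h5' : fderiv ℝ (fun p : E' × E' => chernMap f (push φ p)) q = _ := h5.fderiv
  rw [hev.fderiv_eq, fderiv_fun_add ((h2.clm_apply (differentiableAt_const _)).clm_apply
      (differentiableAt_const _)) ((h3.clm_apply (hb b)).clm_apply (hb c)),
    fderiv_clm_apply (h2.clm_apply (differentiableAt_const _)) (differentiableAt_const _),
    fderiv_clm_apply h2 (differentiableAt_const _),
    fderiv_clm_apply (h3.clm_apply (hb b)) (hb c), fderiv_clm_apply h3 (hb b), h4', h5',
    h.ambient.vertDeriv_chernConnection (h.mapsTo q hq)]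
  simp [h.fderiv_push_horizontal hq, h.fderiv_fderiv_fst_apply hq, chernMap_apply,
    -Prod.mk_add_mk]
  abel

/-- The curvature of the ambient connection along the submanifold. -/
theorem curvature_push (h : LocalImmersion f U φ f' U') (hq : q ∈ U') (a b c : E') :
    curvature (chernConnection f) (push φ q) (fderiv ℝ φ q.1 a) (fderiv ℝ φ q.1 b)
        (fderiv ℝ φ q.1 c)
      = (fderiv ℝ (fun p => ambientDeriv φ (chernConnection f) p b c) q
            (a, -chernSymbol f' q a q.2)
          + chernSymbol f (push φ q) (fderiv ℝ φ q.1 a) (ambientDeriv φ (chernConnection f) q b c)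
          - vertDeriv (chernConnection f) (push φ q) (fderiv ℝ φ q.1 b) (fderiv ℝ φ q.1 c)
            (fderiv ℝ φ q.1 (differenceTensor f φ f' q a q.2) + secondForm f φ q a q.2))
        - (fderiv ℝ (fun p => ambientDeriv φ (chernConnection f) p a c) q
            (b, -chernSymbol f' q b q.2)
          + chernSymbol f (push φ q) (fderiv ℝ φ q.1 b) (ambientDeriv φ (chernConnection f) q a c)
          - vertDeriv (chernConnection f) (push φ q) (fderiv ℝ φ q.1 a) (fderiv ℝ φ q.1 c)
            (fderiv ℝ φ q.1 (differenceTensor f φ f' q b q.2) + secondForm f φ q b q.2)) := by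
  -- Antisymmetrising in `a` and `b` cancels the third derivative of `φ`; the mixed terms in its
  -- second derivative cancel across the two halves.
  have h3 := ((h.contDiffAt_fderiv hq).isSymmSndFDerivAt minSmoothness_two_le).eq a b
  rw [h.ambient.curvature_chernConnection (h.mapsTo q hq), h.fderiv_ambientDeriv_horizontal hq,
    h.fderiv_ambientDeriv_horizontal hq, h.ambientDeriv_eq hq, h.ambientDeriv_eq hq, h3,
    h.fderiv_fderiv_comm hq b a, map_add, map_add]
  abel

variable [FiniteDimensional ℝ E']

/-- A field along the submanifold, paired with the reference vector, is differentiated through its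
tangent part. -/
theorem metricForm_fderiv_horizontal (h : LocalImmersion f U φ f' U') (hq : q ∈ U')
    {W : E' × E' → E} {T : E' × E' → E'} (hW : DifferentiableAt ℝ W q)
    (hT : DifferentiableAt ℝ T q)
    (hWT : ∀ p ∈ U', ∀ z, metricForm f (push φ p) (W p) (fderiv ℝ φ p.1 z)
      = metricForm f' p (T p) z) (a : E') :
    metricForm f (push φ q) (fderiv ℝ W q (a, -chernSymbol f' q a q.2)
          + chernSymbol f (push φ q) (fderiv ℝ φ q.1 a) (W q)) (push φ q).2
      = metricForm f' q (covDerivField (chernConnection f') a T q) q.2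
        - metricForm f (push φ q) (W q)
          (fderiv ℝ φ q.1 (differenceTensor f φ f' q a q.2) + secondForm f φ q a q.2) := by
  have hev : (fun p => metricForm f (push φ p) (W p) (push φ p).2) =ᶠ[nhds q]
      fun p => metricForm f' p (T p) p.2 := by
    filter_upwards [h.eventually_mem hq] with p hp using hWT p hp p.2
  have hm := h.mapsTo q hq
  have h1 : DifferentiableAt ℝ (fun p => metricForm f (push φ p)) q :=
    (h.contDiffAt_metricForm_push hq).differentiableAt (by simp)
  have hp : DifferentiableAt ℝ (push φ) q := (h.contDiffAt_push hq).differentiableAt (by simp)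
  have h2 := (h.ambient.differentiableAt_metricForm hm).hasFDerivAt.comp q hp.hasFDerivAt
  have h2' : fderiv ℝ (fun p : E' × E' => metricForm f (push φ p)) q = _ := h2.fderiv
  have h3 : fderiv ℝ (fun p => (push φ p).2) q = (ContinuousLinearMap.snd ℝ E E).comp _ :=
    (hasFDerivAt_snd.comp q hp.hasFDerivAt).fderiv
  have h4 := DFunLike.congr_fun (hev.fderiv_eq (𝕜 := ℝ)) (a, -chernSymbol f' q a q.2)
  rw [h.induced.fderiv_metricForm_mul_self_horizontal hq hT,
    fderiv_clm_apply (h1.clm_apply hW) hp.snd, fderiv_clm_apply h1 hW, h2', h3] at h4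
  -- The vertical error differentiates the metric into a Cartan tensor with the reference vector in
  -- one slot, hence zero. The error survives only through the derivative of the reference vector
  -- itself.
  simp only [add_apply, ContinuousLinearMap.comp_apply, ContinuousLinearMap.flip_apply,
    ContinuousLinearMap.coe_snd', h.fderiv_push_horizontal hq, map_add,
    h.ambient.fderiv_metricForm_horizontal hm, h.ambient.fderiv_metricForm_vertical_self hm,
    map_neg] at h4
  simp only [map_add, add_apply]
  linarith

/-- The compatibility of the induced connection compared with that of the Levi-Civita-Chern
connection of the induced metric. -/
theorem metricForm_differenceTensor (h : LocalImmersion f U φ f' U') (hq : q ∈ U') (a b c : E') :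
    metricForm f' q (differenceTensor f φ f' q a b) c
        + metricForm f' q b (differenceTensor f φ f' q a c)
        + fderiv ℝ (metricForm f) (push φ q)
          (0, fderiv ℝ φ q.1 (differenceTensor f φ f' q a q.2) + secondForm f φ q a q.2)
          (fderiv ℝ φ q.1 b) (fderiv ℝ φ q.1 c) = 0 := by
  have hm := h.mapsTo q hq
  have hev : (fun p => metricForm f' p b c) =ᶠ[nhds q]
      fun p => metricForm f (push φ p) (fderiv ℝ φ p.1 b) (fderiv ℝ φ p.1 c) := by
    filter_upwards [h.eventually_mem hq] with p hp using h.metricForm_induced hp b c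
  have h1 : DifferentiableAt ℝ (fun p => metricForm f (push φ p)) q :=
    (h.contDiffAt_metricForm_push hq).differentiableAt (by simp)
  have hp : DifferentiableAt ℝ (push φ) q := (h.contDiffAt_push hq).differentiableAt (by simp)
  have hb : ∀ b, DifferentiableAt ℝ (fun p : E' × E' => fderiv ℝ φ p.1 b) q := fun b =>
    ((h.contDiffAt_fderiv_fst hq).differentiableAt (by simp)).clm_apply (differentiableAt_const _)
  have h2 := (h.ambient.differentiableAt_metricForm hm).hasFDerivAt.comp q hp.hasFDerivAt
  have h2' : fderiv ℝ (fun p : E' × E' => metricForm f (push φ p)) q = _ := h2.fderiv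
  have h4 := DFunLike.congr_fun (hev.fderiv_eq (𝕜 := ℝ)) (a, -chernSymbol f' q a q.2)
  rw [h.induced.fderiv_metricForm_apply hq, h.induced.fderiv_metricForm_horizontal hq,
    fderiv_clm_apply (h1.clm_apply (hb b)) (hb c), fderiv_clm_apply h1 (hb b), h2'] at h4
  simp only [add_apply, ContinuousLinearMap.comp_apply, ContinuousLinearMap.flip_apply,
    h.fderiv_fderiv_fst_apply hq, h.fderiv_push_horizontal hq] at h4
  rw [map_add] at h4
  simp only [add_apply, h.ambient.fderiv_metricForm_horizontal hm] at h4
  have e1 := h.metricForm_inducedSymbol hq a b c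
  have e2 := h.metricForm_inducedSymbol hq a c b
  rw [h.ambientDeriv_eq hq, map_add, add_apply] at e1 e2
  rw [h.ambient.metricForm_comm hm _ (fderiv ℝ φ q.1 b),
    h.ambient.metricForm_comm hm _ (fderiv ℝ φ q.1 b), h.induced.metricForm_comm hq _ b] at e2
  simp only [differenceTensor, map_sub, sub_apply] at h4 ⊢
  linarith

theorem metricForm_differenceTensor_self (h : LocalImmersion f U φ f' U') (hq : q ∈ U')
    (a b : E') : metricForm f' q (differenceTensor f φ f' q a b) q.2
      = -metricForm f' q b (differenceTensor f φ f' q a q.2) := by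
  have h1 := h.metricForm_differenceTensor hq a b q.2
  have h2 := h.ambient.fderiv_metricForm_vertical_self (h.mapsTo q hq)
    (fderiv ℝ φ q.1 (differenceTensor f φ f' q a q.2) + secondForm f φ q a q.2) (fderiv ℝ φ q.1 b)
  have h3 : (push φ q).2 = fderiv ℝ φ q.1 q.2 := rfl
  rw [h3] at h2
  linarith

theorem metricForm_differenceTensor_self_self (h : LocalImmersion f U φ f' U') (hq : q ∈ U')
    (a : E') : metricForm f' q (differenceTensor f φ f' q a q.2) q.2 = 0 := by
  have h1 := h.metricForm_differenceTensor_self hq a q.2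
  rw [h.induced.metricForm_comm hq q.2] at h1
  linarith

/-- By symmetry of `Q`, its pairing with any `b` reduces to `g(Q(b, v), v)`, which is zero. -/
theorem differenceTensor_self_self (h : LocalImmersion f U φ f' U') (hq : q ∈ U') :
    differenceTensor f φ f' q q.2 q.2 = 0 := by
  refine h.induced.eq_zero_of_metricForm hq fun b => ?_
  have h1 := h.metricForm_differenceTensor_self hq q.2 b
  rw [h.differenceTensor_comm hq, h.metricForm_differenceTensor_self_self hq] at h1
  rw [h.induced.metricForm_comm hq]
  linarith

/-- Compatibility is used for the triples `(v, a, c)`, `(a, v, c)` and `(c, a, v)`. The last two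
have no Cartan term and show that `g(Q(a, v), c)` is symmetric in `a` and `c`. The first then gives
twice this quantity, and since `Q(v, v) = 0` only `II(v, v)` remains in its Cartan term. -/
theorem metricForm_differenceTensor_right_self (h : LocalImmersion f U φ f' U') (hq : q ∈ U')
    (a c : E') : metricForm f' q (differenceTensor f φ f' q a q.2) c
      = -cartanTensor f (push φ q) (fderiv ℝ φ q.1 a) (fderiv ℝ φ q.1 c)
          (secondForm f φ q q.2 q.2) := by
  have hm := h.mapsTo q hq
  have h1 := h.metricForm_differenceTensor hq q.2 a c
  have h2 := h.metricForm_differenceTensor hq a q.2 c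
  have h3 := h.metricForm_differenceTensor hq c a q.2
  have h4 : (push φ q).2 = fderiv ℝ φ q.1 q.2 := rfl
  rw [← h4, h.ambient.fderiv_metricForm_vertical_self_left hm] at h2
  rw [← h4, h.ambient.fderiv_metricForm_vertical_self hm] at h3
  rw [h.differenceTensor_self_self hq, map_zero, zero_add,
    h.ambient.fderiv_metricForm_vertical_comm hm, h.ambient.fderiv_metricForm_comm hm,
    h.differenceTensor_comm hq q.2 a, h.differenceTensor_comm hq q.2 c] at h1
  rw [h.induced.metricForm_comm hq _ (differenceTensor f φ f' q a c)] at h2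
  rw [h.differenceTensor_comm hq c a] at h3
  rw [h.ambient.cartanTensor_eq hm]
  linarith

end LocalImmersion

/-! ### The Gauss equation in coordinates. -/

namespace LocalImmersion

variable {E : Type*} [NormedAddCommGroup E] [NormedSpace ℝ E] [FiniteDimensional ℝ E]
  {E' : Type*} [NormedAddCommGroup E'] [NormedSpace ℝ E'] [FiniteDimensional ℝ E']
  {f : E × E → ℝ} {U : Set (E × E)} {φ : E' → E} {f' : E' × E' → ℝ}
  {U' : Set (E' × E')} {q : E' × E'}

/-- The function `g_v(Q_v(v, c), v)` vanishes identically. Its horizontal derivative differs from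
the left-hand side only because the first argument of `Q` also moves, with derivative `-Γ(a, v)`. -/
theorem metricForm_covDerivField_differenceTensor (h : LocalImmersion f U φ f' U') (hq : q ∈ U')
    (a c : E') :
    metricForm f' q (covDerivField (chernConnection f') a
        (fun p => differenceTensor f φ f' p q.2 c) q) q.2
      = metricForm f' q (differenceTensor f φ f' q (chernSymbol f' q a q.2) c) q.2 := by
  obtain ⟨L, hL, hLQ⟩ := exists_contDiffOn_clm (fun p hp => h.isLinearMap_differenceTensor hp c)
    (fun a => h.contDiffOn_differenceTensor a c)
  have hLd : DifferentiableAt ℝ L q :=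
    (hL.contDiffAt (h.induced.isOpen.mem_nhds hq)).differentiableAt (by simp)
  have hW : DifferentiableAt ℝ (fun p => L p p.2) q := hLd.clm_apply differentiableAt_snd
  have hev : (fun p : E' × E' => metricForm f' p (L p p.2) p.2) =ᶠ[nhds q] fun _ => 0 := by
    filter_upwards [h.eventually_mem hq] with p hp
    rw [hLQ p hp, h.metricForm_differenceTensor_self hp, h.differenceTensor_self_self hp]
    simp
  have h1 := h.induced.fderiv_metricForm_mul_self_horizontal hq hW a
  have hev' : (fun p => differenceTensor f φ f' p q.2 c) =ᶠ[nhds q] fun p => L p q.2 := by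
    filter_upwards [h.eventually_mem hq] with p hp using (hLQ p hp _).symm
  rw [hev.fderiv_eq, covDerivField_eq _ _ hW, fderiv_clm_apply hLd differentiableAt_snd] at h1
  rw [covDerivField_eq _ _ (h.differentiableAt_differenceTensor hq _ _), hev'.fderiv_eq,
    fderiv_clm_apply hLd (differentiableAt_const _)]
  have hneg := (h.isLinearMap_differenceTensor hq c).map_neg (chernSymbol f' q a q.2)
  simp [fderiv_snd, hLQ q hq, hneg] at h1 ⊢
  linarith

theorem covDerivField_inducedSymbol (h : LocalImmersion f U φ f' U') (hq : q ∈ U') (a b c : E') :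
    covDerivField (chernConnection f') a (fun p => inducedSymbol f φ p b c) q
      = covDerivField (chernConnection f') a (fun p => chernSymbol f' p b c) q
        + covDerivField (chernConnection f') a (fun p => differenceTensor f φ f' p b c) q := by
  have h1 := h.induced.differentiableAt_chernSymbol hq b c
  have h2 := h.differentiableAt_differenceTensor hq b c
  have h3 : (fun p => inducedSymbol f φ p b c)
      = fun p => chernSymbol f' p b c + differenceTensor f φ f' p b c := by
    ext p; simp [differenceTensor]
  rw [h3, covDerivField_eq _ _ h1, covDerivField_eq _ _ h2, covDerivField_eq _ _ (h1.fun_add h2),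
    fderiv_fun_add h1 h2]
  simp only [chernConnection, map_add, add_apply]
  abel

theorem metricForm_covDeriv_ambientDeriv (h : LocalImmersion f U φ f' U') (hq : q ∈ U')
    (a b c : E') :
    metricForm f (push φ q)
        (fderiv ℝ (fun p => ambientDeriv φ (chernConnection f) p b c) q
            (a, -chernSymbol f' q a q.2)
          + chernSymbol f (push φ q) (fderiv ℝ φ q.1 a) (ambientDeriv φ (chernConnection f) q b c))
        (push φ q).2
      = metricForm f' q (covDerivField (chernConnection f') a (fun p => chernSymbol f' p b c) q) q.2
        + metricForm f' q
            (covDerivField (chernConnection f') a (fun p => differenceTensor f φ f' p b c) q) q.2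
        - metricForm f' q (chernSymbol f' q b c + differenceTensor f φ f' q b c)
            (differenceTensor f φ f' q a q.2)
        - metricForm f (push φ q) (secondForm f φ q b c) (secondForm f φ q a q.2) := by
  have hm := h.mapsTo q hq
  rw [h.metricForm_fderiv_horizontal hq
    ((h.contDiffAt_ambientDeriv hq b c).differentiableAt (by simp))
    (((h.contDiffOn_inducedSymbol b c).contDiffAt (h.induced.isOpen.mem_nhds hq)).differentiableAt
      (by simp)) (fun p hp z => (h.metricForm_inducedSymbol hp b c z).symm),
    h.covDerivField_inducedSymbol hq, ambientDeriv_decomp f φ f', map_add, map_add, map_add,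
    add_apply, add_apply, add_apply, h.metricForm_secondForm hq,
    h.ambient.metricForm_comm hm _ (secondForm f φ q a q.2), h.metricForm_secondForm hq,
    ← h.metricForm_induced hq]
  simp only [map_add, add_apply]
  ring

/-- The Gauss equation for the flag curvature, in coordinates. -/
theorem metricForm_curvature (h : LocalImmersion f U φ f' U') (hq : q ∈ U') (u : E') :
    metricForm f' q (curvature (chernConnection f') q q.2 u u) q.2
      = metricForm f (push φ q) (curvature (chernConnection f) (push φ q) (fderiv ℝ φ q.1 q.2)
            (fderiv ℝ φ q.1 u) (fderiv ℝ φ q.1 u)) (push φ q).2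
        + (metricForm f (push φ q) (secondForm f φ q u u) (secondForm f φ q q.2 q.2)
          - metricForm f (push φ q) (secondForm f φ q q.2 u) (secondForm f φ q q.2 u))
        + (metricForm f (push φ q)
            (vertDeriv (chernConnection f) (push φ q) (fderiv ℝ φ q.1 u) (fderiv ℝ φ q.1 u)
                (secondForm f φ q q.2 q.2)
              - fderiv ℝ φ q.1
                (covDerivTensor (chernConnection f') q.2 (differenceTensor f φ f') q u u))
            (push φ q).2
          + cartanTensor f (push φ q) (fderiv ℝ φ q.1 u)
            (fderiv ℝ φ q.1 (differenceTensor f φ f' q q.2 u)) (secondForm f φ q q.2 q.2)) := by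
  have hm := h.mapsTo q hq
  have hv : (push φ q).2 = fderiv ℝ φ q.1 q.2 := rfl
  -- Of the two `P` terms in the curvature, the one containing the flagpole as an argument
  -- disappears on pairing with it; only `P(u, u, II(v, v))` remains, because `Q(v, v) = 0`.
  have hP : ∀ z, metricForm f (push φ q) (vertDeriv (chernConnection f) (push φ q)
      (fderiv ℝ φ q.1 q.2) (fderiv ℝ φ q.1 u) z) (push φ q).2 = 0 := by
    intro z
    rw [h.ambient.vertDeriv_chernConnection hm, ← hv,
      ← h.ambient.metricForm_fderiv_chernMap_self hm (fderiv ℝ φ q.1 u) z,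
      h.ambient.fderiv_chernMap_apply hm, h.ambient.fderiv_chernMap_apply hm]
    congr 3
    refine Filter.EventuallyEq.fderiv_eq ?_
    filter_upwards [h.ambient.isOpen.mem_nhds hm] with p hp using h.ambient.chernSymbol_comm hp _ _
  have h1 := congrArg (fun w => metricForm f (push φ q) w (push φ q).2)
    (h.curvature_push hq q.2 u u)
  simp only [map_sub _ (_ + _) _, map_sub _ (_ - _) _, sub_apply, hP,
    h.metricForm_covDeriv_ambientDeriv hq] at h1
  rw [h.differenceTensor_self_self hq, h.metricForm_covDerivField_differenceTensor hq] at h1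
  simp only [map_zero, zero_add] at h1
  -- The quadratic term `g(Q(v, u), Q(v, u))` is exactly minus the Cartan term of the formula.
  have h2 := h.metricForm_differenceTensor_right_self hq u (differenceTensor f φ f' q q.2 u)
  -- The term `g(Γ(v, u), Q(u, v))` becomes a second copy of `g(Q(Γ(v, u), u), v)`. The two copies
  -- are the Christoffel corrections in `(∇_v Q)(u, u)`.
  have h3 := h.metricForm_differenceTensor_self hq u (chernSymbol f' q q.2 u)
  have h4 := h.differenceTensor_comm hq u q.2
  have h5 := h.secondForm_comm hq u q.2
  rw [covDerivTensor, map_sub, sub_apply, hv, ← h.metricForm_induced hq, curvature]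
  rw [hv] at h1
  simp only [map_sub, sub_apply]
  rw [h.differenceTensor_comm hq (chernSymbol f' q q.2 u) u]
  rw [h.induced.chernSymbol_comm hq u q.2, h.differenceTensor_comm hq (chernSymbol f' q q.2 u) u,
    h4, h5, map_add, add_apply] at h1
  rw [h4] at h2 h3
  linarith

end LocalImmersion

/-! ### From charts to manifolds. -/

theorem LocalMetric.mono {E : Type*} [NormedAddCommGroup E] [NormedSpace ℝ E]
    {f : E × E → ℝ} {U : Set (E × E)} (h : LocalMetric f U) {N : Set E} (hN : IsOpen N) :
    LocalMetric f (U ∩ Prod.fst ⁻¹' N) where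
  isOpen := h.isOpen.inter (hN.preimage continuous_fst)
  smooth := h.smooth.mono Set.inter_subset_left
  conic q hq c hc := ⟨h.conic q hq.1 c hc, hq.2⟩
  homogeneous q hq := h.homogeneous q hq.1
  nondegenerate q hq := h.nondegenerate q hq.1

/-- The domain of `ι`, read in the preferred charts at `p` and `ι p`. -/
def writtenDomain (E : Type*) [TopologicalSpace E]
    {M : Type*} [TopologicalSpace M] [ChartedSpace E M] {E' : Type*} [TopologicalSpace E']
    {S : Type*} [TopologicalSpace S] [ChartedSpace E' S] (ι : S → M) (p : S) : Set E' :=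
  (chartAt E' p).target ∩ (chartAt E' p).symm ⁻¹' (ι ⁻¹' (chartAt E (ι p)).source)

theorem isOpen_writtenDomain {E : Type*} [TopologicalSpace E]
    {M : Type*} [TopologicalSpace M] [ChartedSpace E M] {E' : Type*} [TopologicalSpace E']
    {S : Type*} [TopologicalSpace S] [ChartedSpace E' S] {ι : S → M} (hι : Continuous ι) (p : S) :
    IsOpen (writtenDomain E ι p : Set E') :=
  (chartAt (H := E') p).continuousOn_symm.isOpen_inter_preimage (chartAt (H := E') p).open_target
    ((chartAt E (ι p)).open_source.preimage hι)

theorem tangentMap_congr_of_eventuallyEq {E : Type*} [NormedAddCommGroup E] [NormedSpace ℝ E]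
    {M : Type*} [TopologicalSpace M] [ChartedSpace E M]
    {E' : Type*} [NormedAddCommGroup E'] [NormedSpace ℝ E']
    {S : Type*} [TopologicalSpace S] [ChartedSpace E' S] {g₁ g₂ : S → M} {w : TangentBundle 𝓘(ℝ, E') S}
    (h : g₁ =ᶠ[nhds w.1] g₂) :
    tangentMap 𝓘(ℝ, E') 𝓘(ℝ, E) g₁ w = tangentMap 𝓘(ℝ, E') 𝓘(ℝ, E) g₂ w := by
  refine Bundle.TotalSpace.ext h.eq_of_nhds ?_
  have h1 : (mfderiv 𝓘(ℝ, E') 𝓘(ℝ, E) g₁ w.1 : E' →L[ℝ] E)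
    = (mfderiv 𝓘(ℝ, E') 𝓘(ℝ, E) g₂ w.1 : E' →L[ℝ] E) := h.mfderiv_eq
  have h2 := DFunLike.congr_fun h1 w.2
  exact heq_of_eq h2

theorem fderiv_writtenInExtChartAt {E : Type*} [NormedAddCommGroup E] [NormedSpace ℝ E]
    {M : Type*} [TopologicalSpace M] [ChartedSpace E M]
    {E' : Type*} [NormedAddCommGroup E'] [NormedSpace ℝ E']
    {S : Type*} [TopologicalSpace S] [ChartedSpace E' S] {ι : S → M} (hι : ContMDiff 𝓘(ℝ, E') 𝓘(ℝ, E) ∞ ι) (p : S) :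
    fderiv ℝ (writtenInExtChartAt 𝓘(ℝ, E') 𝓘(ℝ, E) p ι) (extChartAt 𝓘(ℝ, E') p p)
      = mfderiv 𝓘(ℝ, E') 𝓘(ℝ, E) ι p := by
  rw [MDifferentiableAt.mfderiv (hι.mdifferentiable (by simp) p), modelWithCornersSelf_coe,
    Set.range_id, fderivWithin_univ]

section TangentBundle

variable {E : Type*} [NormedAddCommGroup E] [NormedSpace ℝ E]
  {M : Type*} [TopologicalSpace M] [ChartedSpace E M] [IsManifold 𝓘(ℝ, E) ∞ M]
  {E' : Type*} [NormedAddCommGroup E'] [NormedSpace ℝ E']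
  {S : Type*} [TopologicalSpace S] [ChartedSpace E' S] [IsManifold 𝓘(ℝ, E') ∞ S]

/-- The chart of the tangent bundle induced by the preferred chart of the manifold at `x`. -/
theorem extChartAt_tangent_symm (x : M) {q : E × E} (hq : q.1 ∈ (chartAt E x).target) :
    (extChartAt 𝓘(ℝ, E).tangent (⟨x, 0⟩ : TangentBundle 𝓘(ℝ, E) M)).symm q
      = tangentMap 𝓘(ℝ, E) 𝓘(ℝ, E) (chartAt E x).symm (⟨q.1, q.2⟩ : TangentBundle 𝓘(ℝ, E) E) := by
  have := tangentMap_chart_symm (I := 𝓘(ℝ, E)) (p := (⟨x, 0⟩ : TangentBundle 𝓘(ℝ, E) M))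
    (q := (⟨q.1, q.2⟩ : TangentBundle 𝓘(ℝ, E) E)) hq
  rw [this]
  rfl

theorem mem_extChartAt_tangent_target (x : M) (q : E × E) :
    q ∈ (extChartAt 𝓘(ℝ, E).tangent (⟨x, 0⟩ : TangentBundle 𝓘(ℝ, E) M)).target
      ↔ q.1 ∈ (chartAt E x).target := by
  rw [extChartAt_target]
  have h := TangentBundle.mem_chart_target_iff (I := 𝓘(ℝ, E)) (M := M) q ⟨x, 0⟩
  simp only [ModelWithCorners.tangent, mfld_simps]
  exact ⟨fun hq => h.1 hq.1, fun hq => ⟨h.2 hq, q, rfl⟩⟩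

/-- The tangent space at `x` is identified with `E` through the preferred chart at `x`, so at the
centre the differential of that chart is the identity. -/
theorem tangentMap_chartAt_symm_self (x : M) (z : TangentSpace 𝓘(ℝ, E) x) :
    tangentMap 𝓘(ℝ, E) 𝓘(ℝ, E) (chartAt E x).symm
      (⟨chartAt E x x, z⟩ : TangentBundle 𝓘(ℝ, E) E) = ⟨x, z⟩ := by
  refine Bundle.TotalSpace.ext ((chartAt E x).left_inv (mem_chart_source E x)) ?_
  have h := mfderivWithin_range_extChartAt_symm (I := 𝓘(ℝ, E)) (x := x)
  rw [modelWithCornersSelf_coe, Set.range_id, mfderivWithin_univ] at h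
  have h2 := DFunLike.congr_fun h z
  exact heq_of_eq h2

theorem extChartAt_tangent_symm_coord {x : M} (z : TangentSpace 𝓘(ℝ, E) x) :
    (extChartAt 𝓘(ℝ, E).tangent (⟨x, 0⟩ : TangentBundle 𝓘(ℝ, E) M)).symm
      (PseudoFinslerMetric.coord z) = ⟨x, z⟩ := by
  rw [extChartAt_tangent_symm x (q := PseudoFinslerMetric.coord z)
    ((chartAt E x).map_source (mem_chart_source E x))]
  exact tangentMap_chartAt_symm_self x z

theorem contDiffAt_writtenInExtChartAt {ι : S → M} (hι : ContMDiff 𝓘(ℝ, E') 𝓘(ℝ, E) ∞ ι) (p : S)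
    {y : E'} (hy : y ∈ writtenDomain E ι p) :
    ContDiffAt ℝ ∞ (writtenInExtChartAt 𝓘(ℝ, E') 𝓘(ℝ, E) p ι) y := by
  rw [← contMDiffAt_iff_contDiffAt]
  have h1 : ContMDiffAt 𝓘(ℝ, E') 𝓘(ℝ, E') ∞ (extChartAt 𝓘(ℝ, E') p).symm y := by
    refine (contMDiffOn_extChartAt_symm p).contMDiffAt ?_
    exact (isOpen_extChartAt_target p).mem_nhds (by simpa using hy.1)
  have h2 : ContMDiffAt 𝓘(ℝ, E) 𝓘(ℝ, E) ∞ (extChartAt 𝓘(ℝ, E) (ι p))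
      (ι ((extChartAt 𝓘(ℝ, E') p).symm y)) := contMDiffAt_extChartAt' hy.2
  exact h2.comp y (hι.contMDiffAt.comp y h1)

/-- The chain rule on both sides of an identity of maps, inverse chart after `φ` and `ι` after
inverse chart, valid near `y`. It shows that the restricted metric, read in a chart, is the pullback
of the ambient one along `push`. -/
theorem tangentMap_push {ι : S → M} (hι : ContMDiff 𝓘(ℝ, E') 𝓘(ℝ, E) ∞ ι) (p : S)
    {y : E'} (hy : y ∈ writtenDomain E ι p) (z : E') :
    tangentMap 𝓘(ℝ, E) 𝓘(ℝ, E) (chartAt E (ι p)).symm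
        (⟨(push (writtenInExtChartAt 𝓘(ℝ, E') 𝓘(ℝ, E) p ι) (y, z)).1,
          (push (writtenInExtChartAt 𝓘(ℝ, E') 𝓘(ℝ, E) p ι) (y, z)).2⟩ : TangentBundle 𝓘(ℝ, E) E)
      = tangentMap 𝓘(ℝ, E') 𝓘(ℝ, E) ι (tangentMap 𝓘(ℝ, E') 𝓘(ℝ, E') (chartAt E' p).symm
          (⟨y, z⟩ : TangentBundle 𝓘(ℝ, E') E')) := by
  set φ := writtenInExtChartAt 𝓘(ℝ, E') 𝓘(ℝ, E) p ι with hφ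
  have hφd : MDifferentiableAt 𝓘(ℝ, E') 𝓘(ℝ, E) φ y :=
    ((contDiffAt_writtenInExtChartAt hι p hy).differentiableAt (by simp)).mdifferentiableAt
  have hφy : φ y ∈ (chartAt E (ι p)).target := (chartAt E (ι p)).map_source hy.2
  have h1 : (⟨(push φ (y, z)).1, (push φ (y, z)).2⟩ : TangentBundle 𝓘(ℝ, E) E)
      = tangentMap 𝓘(ℝ, E') 𝓘(ℝ, E) φ (⟨y, z⟩ : TangentBundle 𝓘(ℝ, E') E') := by
    rw [tangentMap, mfderiv_eq_fderiv]; rfl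
  have hc := (mdifferentiable_chart (I := 𝓘(ℝ, E)) (ι p)).symm.mdifferentiableAt hφy
  have hc' := (mdifferentiable_chart (I := 𝓘(ℝ, E')) p).symm.mdifferentiableAt hy.1
  rw [h1, ← tangentMap_comp_at _ hc hφd,
    ← tangentMap_comp_at _ (hι.mdifferentiable (by simp) _) hc']
  refine tangentMap_congr_of_eventuallyEq ?_
  filter_upwards [(isOpen_writtenDomain (E := E) hι.continuous p).mem_nhds hy] with r hr
  exact (chartAt E (ι p)).left_inv hr.2

end TangentBundle

namespace PseudoFinslerMetric

variable {E : Type*} [NormedAddCommGroup E] [NormedSpace ℝ E]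
  {M : Type*} [TopologicalSpace M] [ChartedSpace E M] [IsManifold 𝓘(ℝ, E) ∞ M]

/-- The domain of a pseudo-Finsler metric in the chart of `TM` induced by the preferred chart. -/
def chartDomain (F : PseudoFinslerMetric E M) (x : M) : Set (E × E) :=
  (extChartAt 𝓘(ℝ, E).tangent (⟨x, 0⟩ : TangentBundle 𝓘(ℝ, E) M)).target ∩
    (extChartAt 𝓘(ℝ, E).tangent (⟨x, 0⟩ : TangentBundle 𝓘(ℝ, E) M)).symm ⁻¹' F.A

theorem inChart_eq (F : PseudoFinslerMetric E M) (x : M) {y : E} (hy : y ∈ (chartAt E x).target)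
    (z : E) : F.inChart x (y, z)
      = F.L (tangentMap 𝓘(ℝ, E) 𝓘(ℝ, E) (chartAt E x).symm
          (⟨y, z⟩ : TangentBundle 𝓘(ℝ, E) E)) := by
  rw [inChart, extChartAt_tangent_symm x (q := (y, z)) hy]

theorem mem_chartDomain (F : PseudoFinslerMetric E M) (x : M) {q : E × E} :
    q ∈ F.chartDomain x ↔ q.1 ∈ (chartAt E x).target ∧
      tangentMap 𝓘(ℝ, E) 𝓘(ℝ, E) (chartAt E x).symm
        (⟨q.1, q.2⟩ : TangentBundle 𝓘(ℝ, E) E) ∈ F.A := by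
  rw [chartDomain, Set.mem_inter_iff, mem_extChartAt_tangent_target]
  refine and_congr_right fun h => ?_
  rw [Set.mem_preimage, extChartAt_tangent_symm x h]

theorem localMetric_inChart (F : PseudoFinslerMetric E M) (x : M) :
    LocalMetric (F.inChart x) (F.chartDomain x) where
  isOpen := (continuousOn_extChartAt_symm _).isOpen_inter_preimage (isOpen_extChartAt_target _)
    F.isOpen_A
  smooth := by
    have h := F.smooth.comp ((contMDiffOn_extChartAt_symm (n := ∞) (I := 𝓘(ℝ, E).tangent)
      (⟨x, 0⟩ : TangentBundle 𝓘(ℝ, E) M)).mono (Set.inter_subset_left (t :=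
      (extChartAt 𝓘(ℝ, E).tangent (⟨x, 0⟩ : TangentBundle 𝓘(ℝ, E) M)).symm ⁻¹' F.A)))
      Set.inter_subset_right
    exact contMDiffOn_iff_contDiffOn.1 h
  conic q hq c hc := by
    rw [mem_chartDomain] at hq ⊢
    refine ⟨hq.1, ?_⟩
    have h := F.conic _ _ c hc hq.2
    rw [← map_smul] at h
    exact h
  homogeneous q hq c hc := by
    rw [mem_chartDomain] at hq
    rw [F.inChart_eq x hq.1, ← Prod.mk.eta (p := q), F.inChart_eq x hq.1]
    have h := F.homogeneous _ _ c hc hq.2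
    rw [← map_smul] at h
    exact h
  nondegenerate q hq u hu := by
    rw [mem_chartDomain] at hq
    have hs := (mdifferentiable_chart (I := 𝓘(ℝ, E)) x).symm
    have h1 : ∀ w : E, fundForm (fun z => F.L ⟨(chartAt E x).symm q.1, z⟩)
        (mfderiv 𝓘(ℝ, E) 𝓘(ℝ, E) (chartAt E x).symm q.1 q.2)
        (mfderiv 𝓘(ℝ, E) 𝓘(ℝ, E) (chartAt E x).symm q.1 u)
        (mfderiv 𝓘(ℝ, E) 𝓘(ℝ, E) (chartAt E x).symm q.1 w) = 0 := by
      intro w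
      rw [← hu w, fundTensor, funext fun z => F.inChart_eq x hq.1 z]
      exact (fundForm_comp_linear
        (mfderiv 𝓘(ℝ, E) 𝓘(ℝ, E) (chartAt E x).symm q.1).toLinearMap
        (fun z => F.L ⟨(chartAt E x).symm q.1, z⟩) q.2 u w).symm
    -- Nondegeneracy passes to the chart because the differential of the inverse chart is bijective:
    -- surjectivity reaches every test vector, injectivity returns `u = 0`.
    have h2 := F.nondegenerate _ _ hq.2 (mfderiv 𝓘(ℝ, E) 𝓘(ℝ, E) (chartAt E x).symm q.1 u)
      fun w => by
        obtain ⟨w, rfl⟩ := hs.mfderiv_surjective hq.1 w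
        exact h1 w
    exact hs.mfderiv_injective hq.1 (h2.trans (map_zero _).symm)

theorem fundTensor_inChart (F : PseudoFinslerMetric E M) {x : M} (v u w : TangentSpace 𝓘(ℝ, E) x) :
    fundTensor (F.inChart x) (coord v) u w = F.g v u w := by
  have h : (fun z : E => F.inChart x ((coord v).1, z)) = fun z => F.L ⟨x, z⟩ := by
    ext z
    exact congrArg F.L (extChartAt_tangent_symm_coord (x := x) z)
  exact congrArg (fun k : E → ℝ => fundForm (V := E) k v u w) h

theorem cartanTensor_inChart (F : PseudoFinslerMetric E M) {x : M}
    (v u w z : TangentSpace 𝓘(ℝ, E) x) :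
    cartanTensor (F.inChart x) (coord v) u w z = F.cartan v u w z := by
  have h : (fun z : E => F.inChart x ((coord v).1, z)) = fun z => F.L ⟨x, z⟩ := by
    ext z
    exact congrArg F.L (extChartAt_tangent_symm_coord (x := x) z)
  exact congrArg (fun k : E → ℝ => cartanForm (V := E) k v u w z) h

theorem coord_mem_chartDomain (F : PseudoFinslerMetric E M) {x : M} {v : TangentSpace 𝓘(ℝ, E) x} :
    coord v ∈ F.chartDomain x ↔ (⟨x, v⟩ : TangentBundle 𝓘(ℝ, E) M) ∈ F.A := by
  rw [mem_chartDomain]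
  have h : (coord v).1 ∈ (chartAt E x).target := (chartAt E x).map_source (mem_chart_source E x)
  refine (and_iff_right h).trans ?_
  rw [← extChartAt_tangent_symm x (q := coord v) h, extChartAt_tangent_symm_coord]

theorem metricForm_inChart (F : PseudoFinslerMetric E M) {x : M} {v : TangentSpace 𝓘(ℝ, E) x}
    (hv : (⟨x, v⟩ : TangentBundle 𝓘(ℝ, E) M) ∈ F.A) (u w : TangentSpace 𝓘(ℝ, E) x) :
    metricForm (F.inChart x) (coord v) u w = F.g v u w :=
  ((F.localMetric_inChart x).fundTensor_eq (F.coord_mem_chartDomain.2 hv) u w).symm.trans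
    (F.fundTensor_inChart v u w)

variable {E' : Type*} [NormedAddCommGroup E'] [NormedSpace ℝ E']
  {S : Type*} [TopologicalSpace S] [ChartedSpace E' S] [IsManifold 𝓘(ℝ, E') ∞ S]

theorem localImmersion_inChart (F : PseudoFinslerMetric E M) (ι : S → M)
    (hι : F.IsNondegenerate E' ι) (p : S) :
    LocalImmersion (F.inChart (ι p)) (F.chartDomain (ι p))
      (writtenInExtChartAt 𝓘(ℝ, E') 𝓘(ℝ, E) p ι) ((F.restrict ι hι).inChart p)
      ((F.restrict ι hι).chartDomain p ∩ Prod.fst ⁻¹' writtenDomain E ι p) where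
  ambient := F.localMetric_inChart _
  induced := ((F.restrict ι hι).localMetric_inChart p).mono
    (isOpen_writtenDomain (E := E) hι.smooth.continuous p)
  contDiffAt q hq := contDiffAt_writtenInExtChartAt hι.smooth p hq.2
  mapsTo q hq := by
    rw [mem_chartDomain]
    refine ⟨(chartAt E (ι p)).map_source hq.2.2, ?_⟩
    rw [← Prod.mk.eta (p := q), tangentMap_push hι.smooth p hq.2]
    exact ((F.restrict ι hι).mem_chartDomain p).1 hq.1 |>.2
  comp q hq z := by
    have h1 := F.inChart_eq (ι p)
      (y := (push (writtenInExtChartAt 𝓘(ℝ, E') 𝓘(ℝ, E) p ι) (q.1, z)).1)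
      ((chartAt E (ι p)).map_source hq.2.2)
      (push (writtenInExtChartAt 𝓘(ℝ, E') 𝓘(ℝ, E) p ι) (q.1, z)).2
    exact ((F.restrict ι hι).inChart_eq p hq.2.1 z).trans
      ((congrArg F.L (tangentMap_push hι.smooth p hq.2 z)).symm.trans h1.symm)

theorem restrict_g (F : PseudoFinslerMetric E M) (ι : S → M) (hι : F.IsNondegenerate E' ι) {p : S}
    (v u w : TangentSpace 𝓘(ℝ, E') p) :
    (F.restrict ι hι).g v u w = F.g (mfderiv 𝓘(ℝ, E') 𝓘(ℝ, E) ι p v)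
      (mfderiv 𝓘(ℝ, E') 𝓘(ℝ, E) ι p u) (mfderiv 𝓘(ℝ, E') 𝓘(ℝ, E) ι p w) :=
  fundForm_comp_linear (mfderiv 𝓘(ℝ, E') 𝓘(ℝ, E) ι p).toLinearMap
    (fun z => F.L ⟨ι p, z⟩) v u w

theorem push_coord {E : Type*} [NormedAddCommGroup E] [NormedSpace ℝ E]
    {M : Type*} [TopologicalSpace M] [ChartedSpace E M]
    {E' : Type*} [NormedAddCommGroup E'] [NormedSpace ℝ E']
    {S : Type*} [TopologicalSpace S] [ChartedSpace E' S] {ι : S → M} (hι : ContMDiff 𝓘(ℝ, E') 𝓘(ℝ, E) ∞ ι) {p : S}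
    (v : TangentSpace 𝓘(ℝ, E') p) :
    push (writtenInExtChartAt 𝓘(ℝ, E') 𝓘(ℝ, E) p ι) (coord v)
      = coord (mfderiv 𝓘(ℝ, E') 𝓘(ℝ, E) ι p v) := by
  refine Prod.ext ?_ ?_
  · exact congrArg (fun y => extChartAt 𝓘(ℝ, E) (ι p) (ι y)) (extChartAt_to_inv (I := 𝓘(ℝ, E')) p)
  · exact DFunLike.congr_fun (fderiv_writtenInExtChartAt hι p) v

/-- The Gauss equation in the direction of the flag `(v, u)`. -/
theorem g_curvature [FiniteDimensional ℝ E] [FiniteDimensional ℝ E'] (F : PseudoFinslerMetric E M)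
    (ι : S → M) (hι : F.IsNondegenerate E' ι) {p : S} (v u : TangentSpace 𝓘(ℝ, E') p)
    (dι : TangentSpace 𝓘(ℝ, E') p →L[ℝ] TangentSpace 𝓘(ℝ, E) (ι p))
    (hdι : dι = mfderiv 𝓘(ℝ, E') 𝓘(ℝ, E) ι p)
    (hv : (⟨ι p, dι v⟩ : TangentBundle 𝓘(ℝ, E) M) ∈ F.A) :
    (F.restrict ι hι).g v ((F.restrict ι hι).R v v u u) v
      = F.g (dι v) (F.R (dι v) (dι v) (dι u) (dι u)) (dι v)
        + (F.g (dι v) (F.II ι v u u) (F.II ι v v v) - F.g (dι v) (F.II ι v v u) (F.II ι v v u))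
        + (F.g (dι v)
              (F.P (dι v) (dι u) (dι u) (F.II ι v v v) - dι (F.nablaQ ι hι v v u u)) (dι v)
            + F.cartan (dι v) (dι u) (dι (F.Q ι hι v v u)) (F.II ι v v v)) := by
  subst hdι
  have hv' : (⟨p, v⟩ : TangentBundle 𝓘(ℝ, E') S) ∈ (F.restrict ι hι).A := hv
  have hp : (coord v).1 ∈ writtenDomain E ι p := by
    refine ⟨(chartAt E' p).map_source (mem_chart_source E' p), ?_⟩
    have : (chartAt E' p).symm (chartAt E' p p) = p :=
      (chartAt E' p).left_inv (mem_chart_source E' p)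
    change ι ((chartAt E' p).symm (chartAt E' p p)) ∈ (chartAt E (ι p)).source
    rw [this]
    exact mem_chart_source E (ι p)
  have key := (F.localImmersion_inChart ι hι p).metricForm_curvature
    (q := coord v) ⟨(F.restrict ι hι).coord_mem_chartDomain.2 hv', hp⟩ u
  have h0 : fderiv ℝ (writtenInExtChartAt 𝓘(ℝ, E') 𝓘(ℝ, E) p ι) (coord v).1
      = mfderiv 𝓘(ℝ, E') 𝓘(ℝ, E) ι p := fderiv_writtenInExtChartAt hι.smooth p
  have h1 : ∀ a b : E, metricForm (F.inChart (ι p)) (coord (mfderiv 𝓘(ℝ, E') 𝓘(ℝ, E) ι p v)) a b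
      = F.g (mfderiv 𝓘(ℝ, E') 𝓘(ℝ, E) ι p v) a b := F.metricForm_inChart hv
  have h2 : ∀ a b : E', metricForm ((F.restrict ι hι).inChart p) (coord v) a b
      = (F.restrict ι hι).g v a b := (F.restrict ι hι).metricForm_inChart hv'
  have h3 : ∀ a b c : E, cartanTensor (F.inChart (ι p))
      (coord (mfderiv 𝓘(ℝ, E') 𝓘(ℝ, E) ι p v)) a b c
      = F.cartan (mfderiv 𝓘(ℝ, E') 𝓘(ℝ, E) ι p v) a b c := F.cartanTensor_inChart _
  rw [push_coord hι.smooth, h0, h2, h1, h1, h1, h1, h3] at key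
  exact key

end PseudoFinslerMetric

end Finsler

end

theorem corollary3
    {E : Type*} [NormedAddCommGroup E] [NormedSpace ℝ E] [FiniteDimensional ℝ E]
    {M : Type*} [TopologicalSpace M] [ChartedSpace E M] [IsManifold 𝓘(ℝ, E) ∞ M]
    {E' : Type*} [NormedAddCommGroup E'] [NormedSpace ℝ E'] [FiniteDimensional ℝ E']
    {S : Type*} [TopologicalSpace S] [ChartedSpace E' S] [IsManifold 𝓘(ℝ, E') ∞ S]
    (F : Finsler.PseudoFinslerMetric E M) (ι : S → M) (hι : F.IsNondegenerate E' ι)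
    (p : S) (v u : TangentSpace 𝓘(ℝ, E') p)
    (dι : TangentSpace 𝓘(ℝ, E') p →L[ℝ] TangentSpace 𝓘(ℝ, E) (ι p))
    (hdι : dι = mfderiv 𝓘(ℝ, E') 𝓘(ℝ, E) ι p)
    (hv : (⟨ι p, dι v⟩ : TangentBundle 𝓘(ℝ, E) M) ∈ F.A)
    (hu : F.L ⟨ι p, dι v⟩ * F.g (dι v) (dι u) (dι u) - F.g (dι v) (dι v) (dι u) ^ 2 ≠ 0) :
    (F.restrict ι hι).flagCurvature v u
      = F.flagCurvature (dι v) (dι u)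
        + (F.g (dι v) (F.II ι v u u) (F.II ι v v v) - F.g (dι v) (F.II ι v v u) (F.II ι v v u))
          / (F.L ⟨ι p, dι v⟩ * F.g (dι v) (dι u) (dι u) - F.g (dι v) (dι v) (dι u) ^ 2)
        + (F.g (dι v)
              (F.P (dι v) (dι u) (dι u) (F.II ι v v v) - dι (F.nablaQ ι hι v v u u)) (dι v)
            + F.cartan (dι v) (dι u) (dι (F.Q ι hι v v u)) (F.II ι v v v))
          / (F.L ⟨ι p, dι v⟩ * F.g (dι v) (dι u) (dι u) - F.g (dι v) (dι v) (dι u) ^ 2) := by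
  have hg := F.g_curvature ι hι v u dι hdι hv
  -- The fundamental tensor of the restriction is the pullback of the ambient one, so both flag
  -- curvatures have the same denominator.
  have hd : (F.restrict ι hι).flagDenom v u
      = F.L ⟨ι p, dι v⟩ * F.g (dι v) (dι u) (dι u) - F.g (dι v) (dι v) (dι u) ^ 2 := by
    subst hdι
    rw [Finsler.PseudoFinslerMetric.flagDenom, F.restrict_g, F.restrict_g]
    rfl
  rw [Finsler.PseudoFinslerMetric.flagCurvature, Finsler.PseudoFinslerMetric.flagCurvature, hd,
    Finsler.PseudoFinslerMetric.flagDenom, hg, add_div, add_div]
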